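/- Let $T>0$, $A\in\mathbb{R}^{N\times N}$, $B\in\mathbb{R}^{N\times q}$, $x_0\in\mathbb{R}^N$, $x_d\in L^2(0,T;\mathbb{R}^N)$, let $Q\in\mathbb{R}^{N\times N}$ be symmetric positive semidefinite and $R\in\mathbb{R}^{q\times q}$ symmetric positive definite. For $u\in L^2(0,T;\mathbb{R}^q)$ put $$J(u)=\tfrac12\int_0^T\big((x-x_d)^\top Q(x-x_d)+u^\top R u\big)\,\mathrm{d}t,\qquad \dot x(t)=Ax(t)+Bu(t),\quad x(0)=x_0 .$$ Then there is a constant $C=C_{[A,B,x_0,Q,R,x_d,T]}$, depending only on the listed data, such that the following holds. Let $A=\sum_{m=1}^M A_m$, where $\langle x,A_mx\rangle\le 0$ for all $x\in\mathbb{R}^N$ and all $m$. Let $(p_S)_{S\subseteq\{1,\dots,M\}}$ be probabilities ($p_S\ge 0$, $\sum_S p_S=1$) such that $\pi_m:=\sum_{S\ni m}p_S>0$ for all $m$. Put $\mathcal{A}_S=\sum_{m\in S}A_m/\pi_m$ and $\mathrm{Var}[\mathcal{A}]=\sum_S\|\mathcal{A}_S-A\|^2p_S$, with $\|\cdot\|$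 the Euclidean operator norm. Let $0=t_0<t_1<\dots<t_K=T$ and $h=\max_k(t_k-t_{k-1})$. For $\boldsymbol\omega=(\omega_1,\dots,\omega_K)$, with every $\omega_k$ a subset of $\{1,\dots,M\}$, let $\mathcal{A}_h(\boldsymbol\omega,t)=\mathcal{A}_{\omega_k}$ for $t\in[t_{k-1},t_k)$, and let $\mathbb{E}[X]=\sum_{\boldsymbol\omega}X(\boldsymbol\omega)\,p_{\omega_1}\cdots p_{\omega_K}$. Let $J_h(\boldsymbol\omega,u)$ be defined as $J(u)$, but with $x$ replaced by the solution $x_h(\boldsymbol\omega,\cdot)$ of $\dot x_h=\mathcal{A}_h(\boldsymbol\omega,t)x_h+Bu$, $x_h(0)=x_0$. Let $\alpha\ge 0$ and suppose that, for every $\boldsymbol\omega$, the functional $J_h(\boldsymbol\omega,\cdot)$ is $\alpha$-convex on $L^2(0,T;\mathbb{R}^q)$, i.e. $$J_h(\boldsymbol\omega,(1-\theta)u+\theta v)\le(1-\theta)J_h(\boldsymbol\omega,u)+\theta J_h(\boldsymbol\omega,v)-\tfrac{\alpha}{2}\theta(1-\theta)|u-v|^2_{L^2(0,T;\mathbb{R}^q)}$$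 for all $u,v\in L^2(0,T;\mathbb{R}^q)$ and $\theta\in[0,1]$. Let $u^*$ be the minimizer of $J$ and $u_h^*(\boldsymbol\omega)$ the minimizer of $J_h(\boldsymbol\omega,\cdot)$ over $L^2(0,T;\mathbb{R}^q)$, and put $$x_h^*(\boldsymbol\omega,t)=e^{At}x_0+\int_0^te^{A(t-s)}Bu_h^*(\boldsymbol\omega,s)\,\mathrm{d}s,\qquad x^*(t)=e^{At}x_0+\int_0^te^{A(t-s)}Bu^*(s)\,\mathrm{d}s .$$ Then $$\alpha^2\,\mathbb{E}\big[|x_h^*(t)-x^*(t)|^2\big]\le C\,h\,\mathrm{Var}[\mathcal{A}]\qquad\text{for all } t\in[0,T].$$ -/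

import Mathlib

open MeasureTheory Set

noncomputable section

namespace RBM

/-- Column vectors `ℝⁿ` with the Euclidean norm and inner product. -/
abbrev Vec (n : ℕ) : Type := EuclideanSpace ℝ (Fin n)

/-- The operator `x ↦ A x` of a real matrix `A`; its norm `‖op A‖` is the operator norm of `A`
with respect to the Euclidean norms. -/
def op {m n : ℕ} (A : Matrix (Fin m) (Fin n) ℝ) : Vec n →L[ℝ] Vec m :=
  LinearMap.toContinuousLinearMap (Matrix.toEuclideanLin A)

/-- The Hilbert space `L²(0,T;ℝⁿ)`. -/
abbrev L2 (T : ℝ) (n : ℕ) : Type := Lp (Vec n) 2 (volume.restrict (Icc (0 : ℝ) T))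

/-! ### Linear systems with time-dependent coefficients -/

/-- `x` solves `ẋ(t) = 𝒜(t) x(t) + f(t)`, `x(0) = x₀`, on `[0,T]` in the sense of Carathéodory,
that is, `x` is continuous and satisfies the integrated equation. -/
def IsSolution {N : ℕ} (T : ℝ) (𝒜 : ℝ → Matrix (Fin N) (Fin N) ℝ) (f : ℝ → Vec N) (x₀ : Vec N)
    (x : ℝ → Vec N) : Prop :=
  ContinuousOn x (Icc 0 T) ∧
    ∀ t ∈ Icc (0 : ℝ) T, x t = x₀ + ∫ s in (0 : ℝ)..t, (op (𝒜 s) (x s) + f s)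

/-- The state `t ↦ x(t)`, `t ∈ [0,T]`: the solution of `ẋ(t) = 𝒜(t) x(t) + B u(t)`, `x(0) = x₀`.
Existence and uniqueness on `[0,T]` are proved below for the coefficients that are used. -/
def state {N q : ℕ} (T : ℝ) (𝒜 : ℝ → Matrix (Fin N) (Fin N) ℝ) (B : Matrix (Fin N) (Fin q) ℝ)
    (x₀ : Vec N) (u : L2 T q) : ℝ → Vec N :=
  Classical.epsilon (IsSolution T 𝒜 (fun s => op B (u s)) x₀)

/-- The quadratic form `y ↦ yᵀ Q y`. -/
def quad {n : ℕ} (Q : Matrix (Fin n) (Fin n) ℝ) (y : Vec n) : ℝ := inner ℝ y (op Q y)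

/-- The cost `½ ∫₀ᵀ ((x - x_d)ᵀ Q (x - x_d) + uᵀ R u) dt`, where `x` is the state driven by the
control `u` through the dynamics `ẋ = 𝒜(t) x + B u`, `x(0) = x₀`. -/
def cost {N q : ℕ} (T : ℝ) (𝒜 : ℝ → Matrix (Fin N) (Fin N) ℝ) (B : Matrix (Fin N) (Fin q) ℝ)
    (x₀ : Vec N) (Q : Matrix (Fin N) (Fin N) ℝ) (R : Matrix (Fin q) (Fin q) ℝ) (xd : L2 T N)
    (u : L2 T q) : ℝ :=
  (1 / 2) * ∫ t in (0 : ℝ)..T, (quad Q (state T 𝒜 B x₀ u t - xd t) + quad R (u t))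

/-- The original cost functional `J`: the dynamics are `ẋ = A x + B u`. -/
def J {N q : ℕ} (T : ℝ) (A : Matrix (Fin N) (Fin N) ℝ) (B : Matrix (Fin N) (Fin q) ℝ)
    (x₀ : Vec N) (Q : Matrix (Fin N) (Fin N) ℝ) (R : Matrix (Fin q) (Fin q) ℝ) (xd : L2 T N) :
    L2 T q → ℝ :=
  cost T (fun _ => A) B x₀ Q R xd

/-- The trajectory `e^{At} x₀ + ∫₀ᵗ e^{A(t-s)} B u(s) ds` of the original dynamics. -/
def trajectory {N q : ℕ} {T : ℝ} (A : Matrix (Fin N) (Fin N) ℝ) (B : Matrix (Fin N) (Fin q) ℝ)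
    (x₀ : Vec N) (u : L2 T q) (t : ℝ) : Vec N :=
  NormedSpace.exp (t • op A) x₀ +
    ∫ s in (0 : ℝ)..t, NormedSpace.exp ((t - s) • op A) (op B (u s))

/-! ### The random batch method

The subsets `S_ω` of the index set of the submatrices are used as their own indices `ω`. -/

/-- `π_m`, the probability that `m` belongs to the selected subset. -/
def inclProb {M : ℕ} (p : Finset (Fin M) → ℝ) (m : Fin M) : ℝ :=
  ∑ S : Finset (Fin M), if m ∈ S then p S else 0

/-- `𝒜_S = ∑_{m ∈ S} A_m / π_m`. -/
def batch {M N : ℕ} (Am : Fin M → Matrix (Fin N) (Fin N) ℝ) (p : Finset (Fin M) → ℝ)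
    (S : Finset (Fin M)) : Matrix (Fin N) (Fin N) ℝ :=
  ∑ m ∈ S, (inclProb p m)⁻¹ • Am m

/-- `Var[𝒜] = ∑_S ‖𝒜_S - A‖² p_S`. -/
def variance {M N : ℕ} (A : Matrix (Fin N) (Fin N) ℝ) (Am : Fin M → Matrix (Fin N) (Fin N) ℝ)
    (p : Finset (Fin M) → ℝ) : ℝ :=
  ∑ S : Finset (Fin M), ‖op (batch Am p S - A)‖ ^ 2 * p S

/-- The sample space `Ω^K`: one subset for each of the `K` time intervals. -/
abbrev Sample (K M : ℕ) : Type := Fin K → Finset (Fin M)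

/-- The expectation of a random variable: the intervals choose their subsets independently. -/
def expect {K M : ℕ} (p : Finset (Fin M) → ℝ) (X : Sample K M → ℝ) : ℝ :=
  ∑ ω : Sample K M, X ω * ∏ k, p (ω k)

/-- `h`, the largest of the steps `t_k - t_{k-1}`. -/
def meshSize {K : ℕ} (τ : Fin (K + 1) → ℝ) : ℝ := ⨆ k : Fin K, (τ k.succ - τ k.castSucc)

/-- The piecewise constant matrix `𝒜_h(ω, t)`, equal to `𝒜_{ω_k}` on the `k`-th interval
`[t_{k-1}, t_k)` of the grid. -/
def batchPath {K M N : ℕ} (Am : Fin M → Matrix (Fin N) (Fin N) ℝ) (p : Finset (Fin M) → ℝ)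
    (τ : Fin (K + 1) → ℝ) (ω : Sample K M) (t : ℝ) : Matrix (Fin N) (Fin N) ℝ :=
  ∑ k : Fin K, (Ico (τ k.castSucc) (τ k.succ)).indicator (fun _ => batch Am p (ω k)) t

/-- The cost functional `J_h(ω, ·)`: the dynamics are `ẋ_h = 𝒜_h(ω, t) x_h + B u`. -/
def Jh {K M N q : ℕ} (T : ℝ) (Am : Fin M → Matrix (Fin N) (Fin N) ℝ) (p : Finset (Fin M) → ℝ)
    (τ : Fin (K + 1) → ℝ) (B : Matrix (Fin N) (Fin q) ℝ) (x₀ : Vec N)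
    (Q : Matrix (Fin N) (Fin N) ℝ) (R : Matrix (Fin q) (Fin q) ℝ) (xd : L2 T N)
    (ω : Sample K M) : L2 T q → ℝ :=
  cost T (batchPath Am p τ ω) B x₀ Q R xd

/-! ### The state is well defined -/

/-- Existence and uniqueness of a continuous solution on `[0,T]` for bounded measurable coefficients. -/
theorem existsUnique_continuous {E : Type*} [NormedAddCommGroup E] [NormedSpace ℝ E] [CompleteSpace E]
    {T L : ℝ} (hT : 0 ≤ T) (hL : 0 ≤ L) (G : ℝ → E →L[ℝ] E)
    (hG : StronglyMeasurable G) (hGL : ∀ s, ‖G s‖ ≤ L) (f : ℝ → E)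
    (hf : IntegrableOn f (Icc 0 T)) (x₀ : E) :
    ∃! z : C(Icc (0 : ℝ) T, E), ∀ t : Icc (0 : ℝ) T,
      z t = x₀ + ∫ s in (0 : ℝ)..t, (G s (z (projIcc 0 T hT s)) + f s) := by
  have hint : ∀ z : C(Icc (0 : ℝ) T, E),
      IntegrableOn (fun s => G s (z (projIcc 0 T hT s)) + f s) (Icc 0 T) := by
    intro z
    refine Integrable.add ?_ hf
    have hm : AEStronglyMeasurable (fun s => G s (z (projIcc 0 T hT s))) volume := by
      have h2 : Continuous (fun s => z (projIcc 0 T hT s)) := by fun_prop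
      exact (ContinuousLinearMap.apply ℝ E).flip.aestronglyMeasurable_comp₂
          hG.aestronglyMeasurable h2.aestronglyMeasurable
    refine Measure.integrableOn_of_bounded (M := L * ‖z‖) (by simp) hm ?_
    filter_upwards with s
    calc _ ≤ ‖G s‖ * ‖z (projIcc 0 T hT s)‖ := (G s).le_opNorm _
      _ ≤ L * ‖z‖ := by
        gcongr
        · exact hGL s
        · exact z.norm_coe_le_norm _
  have hii : ∀ z : C(Icc (0 : ℝ) T, E), ∀ t : Icc (0 : ℝ) T,
      IntervalIntegrable (fun s => G s (z (projIcc 0 T hT s)) + f s) volume 0 t := by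
    intro z t
    rw [intervalIntegrable_iff_integrableOn_Icc_of_le t.2.1]
    exact (hint z).mono_set (Icc_subset_Icc le_rfl t.2.2)
  have hcont : ∀ z : C(Icc (0 : ℝ) T, E), Continuous (fun t : Icc (0 : ℝ) T =>
      x₀ + ∫ s in (0 : ℝ)..t, (G s (z (projIcc 0 T hT s)) + f s)) := by
    intro z
    have h := intervalIntegral.continuousOn_primitive_interval
      (μ := volume) (a := (0 : ℝ)) (b := T)
      (f := fun s => G s (z (projIcc 0 T hT s)) + f s) (by rw [uIcc_of_le hT]; exact hint z)
    rw [uIcc_of_le hT] at h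
    exact continuous_const.add (continuousOn_iff_continuous_domRestrict.1 h)
  let Φ : C(Icc (0 : ℝ) T, E) → C(Icc (0 : ℝ) T, E) := fun z => ⟨_, hcont z⟩
  have hΦ : ∀ z t, Φ z t = x₀ + ∫ s in (0 : ℝ)..t, (G s (z (projIcc 0 T hT s)) + f s) :=
    fun _ _ => rfl
  have hiter : ∀ (n : ℕ) (z w : C(Icc (0 : ℝ) T, E)) (t : Icc (0 : ℝ) T),
      ‖Φ^[n] z t - Φ^[n] w t‖ ≤ (L * t) ^ n / n.factorial * dist z w := by
    intro n z w
    induction n with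
    | zero =>
      intro t
      simpa [← dist_eq_norm] using ContinuousMap.dist_apply_le_dist t
    | succ n ih =>
      intro t
      rw [Function.iterate_succ_apply', Function.iterate_succ_apply', hΦ, hΦ,
        add_sub_add_left_eq_sub, ← intervalIntegral.integral_sub (hii _ t) (hii _ t)]
      have hb : ∀ s ∈ Ioc (0 : ℝ) t,
          ‖(G s ((Φ^[n] z) (projIcc 0 T hT s)) + f s) -
            (G s ((Φ^[n] w) (projIcc 0 T hT s)) + f s)‖ ≤
          L ^ (n + 1) / n.factorial * dist z w * s ^ n := by
        intro s hs
        have hs' : s ∈ Icc 0 T := ⟨hs.1.le, hs.2.trans t.2.2⟩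
        rw [add_sub_add_right_eq_sub, ← map_sub, projIcc_of_mem hT hs']
        calc _ ≤ ‖G s‖ * ‖(Φ^[n] z) ⟨s, hs'⟩ - (Φ^[n] w) ⟨s, hs'⟩‖ := (G s).le_opNorm _
          _ ≤ L * ((L * s) ^ n / n.factorial * dist z w) := by
            gcongr
            · exact hGL s
            · exact ih ⟨s, hs'⟩
          _ = _ := by rw [mul_pow]; ring
      refine (intervalIntegral.norm_integral_le_of_norm_le t.2.1
        (Filter.Eventually.of_forall hb) (Continuous.intervalIntegrable (by fun_prop) _ _)).trans
        (le_of_eq ?_)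
      rw [intervalIntegral.integral_const_mul, integral_pow, Nat.factorial_succ]
      push_cast
      have : (n.factorial : ℝ) ≠ 0 := by positivity
      field_simp
      ring
  obtain ⟨n, hn⟩ := ((FloorSemiring.tendsto_pow_div_factorial_atTop (L * T)).eventually
    (gt_mem_nhds zero_lt_one)).exists
  have hc : ContractingWith ((L * T) ^ n / n.factorial).toNNReal Φ^[n] := by
    refine ⟨by rwa [Real.toNNReal_lt_one], LipschitzWith.of_dist_le_mul fun z w => ?_⟩
    have h0 : 0 ≤ (L * T) ^ n / n.factorial := by positivity
    rw [Real.coe_toNNReal _ h0, ContinuousMap.dist_le (by positivity)]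
    intro t
    rw [dist_eq_norm]
    refine (hiter n z w t).trans ?_
    have := t.2.1
    have := t.2.2
    gcongr
  have : Nonempty C(Icc (0 : ℝ) T, E) := ⟨0⟩
  have hfix := hc.isFixedPt_fixedPoint_iterate
  refine ⟨hc.fixedPoint, fun t => ?_, fun w hw => ?_⟩
  · conv_lhs => rw [← hfix.eq]
    rfl
  · refine hc.fixedPoint_unique (Function.IsFixedPt.iterate (f := Φ) ?_ n)
    exact ContinuousMap.ext fun t => (hw t).symm

/-- Existence, and uniqueness on `[0,T]`, for bounded measurable coefficients. -/
theorem exists_isSolution {N : ℕ} {T : ℝ} (hT : 0 ≤ T) {𝒜 : ℝ → Matrix (Fin N) (Fin N) ℝ}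
    (h𝒜 : StronglyMeasurable fun s => op (𝒜 s)) {L : ℝ} (hL : ∀ s, ‖op (𝒜 s)‖ ≤ L)
    {f : ℝ → Vec N} (hf : IntegrableOn f (Icc 0 T)) (x₀ : Vec N) :
    ∃ x, IsSolution T 𝒜 f x₀ x ∧ ∀ y, IsSolution T 𝒜 f x₀ y → EqOn y x (Icc 0 T) := by
  obtain ⟨z, hz, hu⟩ := existsUnique_continuous hT ((norm_nonneg _).trans (hL 0)) _ h𝒜 hL f hf x₀
  refine ⟨fun s => z (projIcc 0 T hT s), ⟨?_, fun t ht => ?_⟩, fun y hy t ht => ?_⟩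
  · exact (by fun_prop : Continuous fun s => z (projIcc 0 T hT s)).continuousOn
  · beta_reduce
    rw [projIcc_of_mem hT ht]
    exact hz ⟨t, ht⟩
  · let w : C(Icc (0 : ℝ) T, Vec N) := ⟨(Icc 0 T).domRestrict y, hy.1.domRestrict⟩
    have hw : w = z := by
      refine hu w fun t => ?_
      change y t = _
      rw [hy.2 t t.2]
      congr 1
      refine intervalIntegral.integral_congr fun s hs => ?_
      rw [uIcc_of_le t.2.1] at hs
      have hs' : s ∈ Icc 0 T := ⟨hs.1, hs.2.trans t.2.2⟩
      simp only [projIcc_of_mem hT hs']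
      rfl
    simp only [projIcc_of_mem hT ht, ← hw]
    rfl

theorem op_sum {ι : Type*} {m n : ℕ} (s : Finset ι) (F : ι → Matrix (Fin m) (Fin n) ℝ) :
    op (∑ i ∈ s, F i) = ∑ i ∈ s, op (F i) := by
  simp [op]

theorem op_batchPath {K M N : ℕ} (Am : Fin M → Matrix (Fin N) (Fin N) ℝ)
    (p : Finset (Fin M) → ℝ) (τ : Fin (K + 1) → ℝ) (ω : Sample K M) :
    (fun s => op (batchPath Am p τ ω s)) = fun s => ∑ k : Fin K,
      (Ico (τ k.castSucc) (τ k.succ)).indicator (fun _ => op (batch Am p (ω k))) s := by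
  funext s
  rw [batchPath, op_sum]
  refine Finset.sum_congr rfl fun k _ => ?_
  by_cases hs : s ∈ Ico (τ k.castSucc) (τ k.succ)
  · simp [hs]
  · simp [hs, op]

theorem integrableOn_input {N q : ℕ} {T : ℝ} (B : Matrix (Fin N) (Fin q) ℝ) (u : L2 T q) :
    IntegrableOn (fun s => op B (u s)) (Icc 0 T) :=
  (op B).integrable_comp ((Lp.memLp u).integrable (by norm_num))

/-- The state of the original dynamics is the unique solution of `ẋ = A x + B u`, `x(0) = x₀`. -/
theorem state_original {N q : ℕ} {T : ℝ} (hT : 0 ≤ T) (A : Matrix (Fin N) (Fin N) ℝ)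
    (B : Matrix (Fin N) (Fin q) ℝ) (x₀ : Vec N) (u : L2 T q) :
    IsSolution T (fun _ => A) (fun s => op B (u s)) x₀ (state T (fun _ => A) B x₀ u) ∧
      ∀ y, IsSolution T (fun _ => A) (fun s => op B (u s)) x₀ y →
        EqOn y (state T (fun _ => A) B x₀ u) (Icc 0 T) := by
  obtain ⟨x, hx, hu⟩ := exists_isSolution hT (𝒜 := fun _ => A) stronglyMeasurable_const
    (fun _ => le_rfl) (integrableOn_input B u) x₀
  have h := Classical.epsilon_spec (p := IsSolution T (fun _ => A) (fun s => op B (u s)) x₀)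
    ⟨x, hx⟩
  exact ⟨h, fun y hy => (hu y hy).trans (hu _ h).symm⟩

/-- The state of the randomized dynamics is the unique solution of `ẋ = 𝒜_h(ω, t) x + B u`,
`x(0) = x₀`. -/
theorem state_batch {K M N q : ℕ} {T : ℝ} (hT : 0 ≤ T) (Am : Fin M → Matrix (Fin N) (Fin N) ℝ)
    (p : Finset (Fin M) → ℝ) (τ : Fin (K + 1) → ℝ) (ω : Sample K M)
    (B : Matrix (Fin N) (Fin q) ℝ) (x₀ : Vec N) (u : L2 T q) :
    IsSolution T (batchPath Am p τ ω) (fun s => op B (u s)) x₀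
        (state T (batchPath Am p τ ω) B x₀ u) ∧
      ∀ y, IsSolution T (batchPath Am p τ ω) (fun s => op B (u s)) x₀ y →
        EqOn y (state T (batchPath Am p τ ω) B x₀ u) (Icc 0 T) := by
  have hm : StronglyMeasurable fun s => op (batchPath Am p τ ω s) := by
    rw [op_batchPath]
    exact Finset.stronglyMeasurable_fun_sum _ fun k _ =>
      stronglyMeasurable_const.indicator measurableSet_Ico
  have hb : ∀ s, ‖op (batchPath Am p τ ω s)‖ ≤ ∑ k : Fin K, ‖op (batch Am p (ω k))‖ := by
    intro s
    rw [congrFun (op_batchPath Am p τ ω) s]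
    exact (norm_sum_le _ _).trans (Finset.sum_le_sum fun k _ => norm_indicator_le_norm_self _ _)
  obtain ⟨x, hx, hu⟩ := exists_isSolution hT hm hb (integrableOn_input B u) x₀
  have h := Classical.epsilon_spec
    (p := IsSolution T (batchPath Am p τ ω) (fun s => op B (u s)) x₀) ⟨x, hx⟩
  exact ⟨h, fun y hy => (hu y hy).trans (hu _ h).symm⟩

end RBM

end

noncomputable section

namespace RBM

/-! ### Exponentials of dissipative operators and one random step -/

section Exponential

variable {E : Type*} [NormedAddCommGroup E] [InnerProductSpace ℝ E] [CompleteSpace E]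

/-! The proof splits into a probabilistic estimate for the evolution operators and a deterministic
estimate for the optimal controls.

Evolution operators. The random generators have mean `op A`, and all generators are dissipative, so
every exponential is a contraction and no growth factor involving the decomposition appears. By
Duhamel's formula, exp(δG) - exp(δF) is a term linear in G - F plus a remainder of size δ²‖G - F‖².
The linear term has mean zero, so in the squared error after one step it contributes nothing at
first order in δ, and the mean squared error grows by at most a multiple of δ² times the variance
(`sum_norm_sq_step_le`). Independence lets these increments add up (`sum_norm_sq_evol_le`). Since
the sum of the δ_k² is at most hT, the expected squared distance of the two evolutions is O(h Var),
uniformly in (t, s) (`sum_norm_sq_evolution_sub_le`).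

Optimal controls. The variation of constants formula writes every state as an evolution applied to
the initial value and the input; `IsEvolution` records the only facts used afterwards. The state is
affine in the control, so both costs are quadratic on the line through u* and u_h*. Stationarity of
each minimizer and α-convexity give α‖u_h* - u*‖² ≤ (J' - J_h')(u*)(u_h* - u*)
(`mul_norm_sq_le_of_isMinOn`). The right side is at most ‖u_h* - u*‖ times a weighted integral of
the evolution error. The weight needs a bound for u* alone, which comes from J(u*) ≤ J(0) and the
positivity of R; no bound for the random control is needed. Cauchy-Schwarz then controls α²‖u_h* -
u*‖² by the squared evolution error (`IsEvolution.sq_mul_norm_sub_sq_le`).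

Both trajectories in the conclusion follow the dynamics of A, so their difference is a bounded
linear image of u_h* - u*. Taking expectations finishes the proof. -/

theorem continuous_exp_clm : Continuous (NormedSpace.exp : (E →L[ℝ] E) → (E →L[ℝ] E)) :=
  letI := NormedAlgebra.restrictScalars ℚ ℝ (E →L[ℝ] E)
  NormedSpace.exp_continuous

theorem hasDerivAt_exp_smul (G : E →L[ℝ] E) (t : ℝ) :
    HasDerivAt (fun s : ℝ => NormedSpace.exp (s • G)) (NormedSpace.exp (t • G) * G) t :=
  hasDerivAt_exp_smul_const G t

theorem hasDerivAt_exp_smul' (G : E →L[ℝ] E) (t : ℝ) :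
    HasDerivAt (fun s : ℝ => NormedSpace.exp (s • G)) (G * NormedSpace.exp (t • G)) t :=
  hasDerivAt_exp_smul_const' G t

/-- The semigroup generated by a dissipative operator is contractive. -/
theorem norm_exp_smul_apply_le {G : E →L[ℝ] E} (hG : ∀ x, inner ℝ x (G x) ≤ 0) {t : ℝ}
    (ht : 0 ≤ t) (x : E) : ‖NormedSpace.exp (t • G) x‖ ≤ ‖x‖ := by
  have hd : ∀ s : ℝ, HasDerivAt (fun s : ℝ => ‖NormedSpace.exp (s • G) x‖ ^ 2)
      (2 * inner ℝ (NormedSpace.exp (s • G) x) (G (NormedSpace.exp (s • G) x))) s := fun s => by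
    have h := (hasDerivAt_exp_smul' G s).clm_apply (hasDerivAt_const s x)
    simpa using h.norm_sq
  have hanti : Antitone (fun s : ℝ => ‖NormedSpace.exp (s • G) x‖ ^ 2) := by
    refine antitone_of_deriv_nonpos (fun s => (hd s).differentiableAt) fun s => ?_
    rw [(hd s).deriv]
    linarith [hG (NormedSpace.exp (s • G) x)]
  have h := hanti ht
  simp only [zero_smul, NormedSpace.exp_zero, one_apply_eq_self] at h
  exact (sq_le_sq₀ (norm_nonneg _) (norm_nonneg _)).1 h

theorem norm_exp_smul_le_one {G : E →L[ℝ] E} (hG : ∀ x, inner ℝ x (G x) ≤ 0) {t : ℝ}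
    (ht : 0 ≤ t) : ‖NormedSpace.exp (t • G)‖ ≤ 1 :=
  ContinuousLinearMap.opNorm_le_bound _ zero_le_one fun x => by
    simpa using norm_exp_smul_apply_le hG ht x

/-- Duhamel's formula for the difference of two exponentials. -/
theorem exp_sub_exp_eq_integral (F G : E →L[ℝ] E) (δ : ℝ) :
    NormedSpace.exp (δ • G) - NormedSpace.exp (δ • F) =
      ∫ s in (0 : ℝ)..δ, NormedSpace.exp ((δ - s) • F) * (G - F) * NormedSpace.exp (s • G) := by
  have hd : ∀ s : ℝ, HasDerivAt
      (fun s : ℝ => NormedSpace.exp ((δ - s) • F) * NormedSpace.exp (s • G))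
      (NormedSpace.exp ((δ - s) • F) * (G - F) * NormedSpace.exp (s • G)) s := fun s => by
    have h1 : HasDerivAt (fun s : ℝ => NormedSpace.exp ((δ - s) • F))
        (-(NormedSpace.exp ((δ - s) • F) * F)) s := by
      have := (hasDerivAt_exp_smul F (δ - s)).scomp s ((hasDerivAt_id s).const_sub δ)
      simpa [Function.comp_def] using this
    convert! h1.mul (hasDerivAt_exp_smul' G s) using 1
    noncomm_ring
  rw [intervalIntegral.integral_eq_sub_of_hasDerivAt (fun s _ => hd s)]
  · simp
  · refine Continuous.intervalIntegrable ?_ _ _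
    have := continuous_exp_clm (E := E)
    fun_prop

/-- Both exponential factors in Duhamel's integrand are contractions, so the bound is linear in δ
with constant one. -/
theorem norm_exp_sub_exp_le {F G : E →L[ℝ] E} (hF : ∀ x, inner ℝ x (F x) ≤ 0)
    (hG : ∀ x, inner ℝ x (G x) ≤ 0) {δ : ℝ} (hδ : 0 ≤ δ) :
    ‖NormedSpace.exp (δ • G) - NormedSpace.exp (δ • F)‖ ≤ δ * ‖G - F‖ := by
  rw [exp_sub_exp_eq_integral]
  have := intervalIntegral.norm_integral_le_of_norm_le_const (a := 0) (b := δ)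
    (C := ‖G - F‖) (f := fun s => NormedSpace.exp ((δ - s) • F) * (G - F) *
      NormedSpace.exp (s • G)) fun s hs => by
    rw [uIoc_of_le hδ] at hs
    calc _ ≤ ‖NormedSpace.exp ((δ - s) • F)‖ * ‖G - F‖ * ‖NormedSpace.exp (s • G)‖ :=
          (norm_mul_le _ _).trans (mul_le_mul_of_nonneg_right (norm_mul_le _ _) (norm_nonneg _))
      _ ≤ 1 * ‖G - F‖ * 1 := by
        gcongr
        · exact norm_exp_smul_le_one hF (by linarith [hs.2])
        · exact norm_exp_smul_le_one hG hs.1.le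
      _ = _ := by ring
  rw [sub_zero, abs_of_nonneg hδ] at this
  linarith

/-- The first variation of `exp (δ F)` in the direction `X`. -/
def expVariation (F : E →L[ℝ] E) (δ : ℝ) (X : E →L[ℝ] E) : E →L[ℝ] E :=
  ∫ s in (0 : ℝ)..δ, NormedSpace.exp ((δ - s) • F) * X * NormedSpace.exp (s • F)

theorem intervalIntegrable_expVariation (F : E →L[ℝ] E) (δ : ℝ) (X : E →L[ℝ] E) :
    IntervalIntegrable (fun s => NormedSpace.exp ((δ - s) • F) * X * NormedSpace.exp (s • F))
      volume 0 δ := by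
  refine Continuous.intervalIntegrable ?_ _ _
  have := continuous_exp_clm (E := E)
  fun_prop

/-- Linearity in the direction: this lets a vanishing mean of the directions G_i - F pass to the
variations. -/
theorem sum_smul_expVariation {ι : Type*} (s : Finset ι) (w : ι → ℝ) (X : ι → E →L[ℝ] E)
    (F : E →L[ℝ] E) (δ : ℝ) :
    ∑ i ∈ s, w i • expVariation F δ (X i) = expVariation F δ (∑ i ∈ s, w i • X i) := by
  simp only [expVariation]
  rw [← Finset.sum_congr rfl fun i _ => intervalIntegral.integral_smul (w i) _,
    ← intervalIntegral.integral_finsetSum]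
  · simp [Finset.mul_sum, Finset.sum_mul]
  · intro i _
    exact (intervalIntegrable_expVariation F δ (X i)).smul (w i)

/-- Duhamel's integrand and that of the variation differ only in the last factor, exp(sG) against
exp(sF). Their distance is at most δ‖G - F‖, which supplies the second power of both δ and ‖G - F‖.
-/
theorem norm_exp_sub_exp_sub_variation_le {F G : E →L[ℝ] E} (hF : ∀ x, inner ℝ x (F x) ≤ 0)
    (hG : ∀ x, inner ℝ x (G x) ≤ 0) {δ : ℝ} (hδ : 0 ≤ δ) :
    ‖NormedSpace.exp (δ • G) - NormedSpace.exp (δ • F) - expVariation F δ (G - F)‖ ≤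
      δ ^ 2 * ‖G - F‖ ^ 2 := by
  have hc := continuous_exp_clm (E := E)
  rw [exp_sub_exp_eq_integral, expVariation, ← intervalIntegral.integral_sub
    (Continuous.intervalIntegrable (by fun_prop) _ _) (intervalIntegrable_expVariation F δ _)]
  have := intervalIntegral.norm_integral_le_of_norm_le_const (a := 0) (b := δ)
    (C := δ * ‖G - F‖ ^ 2) (f := fun s => NormedSpace.exp ((δ - s) • F) * (G - F) *
      NormedSpace.exp (s • G) - NormedSpace.exp ((δ - s) • F) * (G - F) *
      NormedSpace.exp (s • F)) fun s hs => by
    rw [uIoc_of_le hδ] at hs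
    rw [← mul_sub]
    calc _ ≤ ‖NormedSpace.exp ((δ - s) • F)‖ * ‖G - F‖ *
            ‖NormedSpace.exp (s • G) - NormedSpace.exp (s • F)‖ :=
          (norm_mul_le _ _).trans (mul_le_mul_of_nonneg_right (norm_mul_le _ _) (norm_nonneg _))
      _ ≤ 1 * ‖G - F‖ * (δ * ‖G - F‖) := by
        gcongr
        · exact norm_exp_smul_le_one hF (by linarith [hs.2])
        · refine (norm_exp_sub_exp_le hF hG hs.1.le).trans ?_
          gcongr
          exact hs.2
      _ = _ := by ring
  rw [sub_zero, abs_of_nonneg hδ] at this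
  linarith

/-- One step of the random batch method: the mean squared error grows by a term of second order
in the step length. -/
theorem sum_norm_sq_step_le {ι : Type*} [Fintype ι] {p : ι → ℝ} (hp : ∀ i, 0 ≤ p i)
    (hp1 : ∑ i, p i = 1) {F : E →L[ℝ] E} {G : ι → E →L[ℝ] E} (hF : ∀ x, inner ℝ x (F x) ≤ 0)
    (hG : ∀ i x, inner ℝ x (G i x) ≤ 0) (hmean : ∑ i, p i • G i = F) {δ ρ : ℝ} (hδ : 0 ≤ δ)
    {a b : E} (ha : ‖a‖ ≤ ρ) (hb : ‖b‖ ≤ ρ) :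
    ∑ i, p i * ‖NormedSpace.exp (δ • G i) a - NormedSpace.exp (δ • F) b‖ ^ 2 ≤
      ‖a - b‖ ^ 2 + 9 * ρ ^ 2 * δ ^ 2 * ∑ i, p i * ‖G i - F‖ ^ 2 := by
  have hρ : 0 ≤ ρ := (norm_nonneg _).trans ha
  have hab : ‖a - b‖ ≤ 2 * ρ := (norm_sub_le _ _).trans (by linarith)
  set P := NormedSpace.exp (δ • F)
  have hP : ‖P (a - b)‖ ≤ 2 * ρ := (norm_exp_smul_apply_le hF hδ _).trans hab
  -- The 9 is 4 + 4 + 1: the doubled inner products `h3` and `h4` give 4 each and the square `h6`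
  -- gives 1. The remaining inner product is linear in G_i - F and is kept exactly, since only its
  -- mean is small.
  have hstep : ∀ i, ‖NormedSpace.exp (δ • G i) a - P b‖ ^ 2 ≤
      ‖a - b‖ ^ 2 + 9 * ρ ^ 2 * δ ^ 2 * ‖G i - F‖ ^ 2 +
        2 * inner ℝ (P (a - b)) (expVariation F δ (G i - F) b) := by
    intro i
    set P' := NormedSpace.exp (δ • G i)
    have hD : ‖P' - P‖ ≤ δ * ‖G i - F‖ := norm_exp_sub_exp_le hF (hG i) hδ
    have hDb : ‖(P' - P) b‖ ≤ δ * ‖G i - F‖ * ρ :=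
      ((P' - P).le_opNorm _).trans (by gcongr)
    have hDe : ‖(P' - P) (a - b)‖ ≤ δ * ‖G i - F‖ * (2 * ρ) :=
      ((P' - P).le_opNorm _).trans (by gcongr)
    have hV : ‖(P' - P - expVariation F δ (G i - F)) b‖ ≤ δ ^ 2 * ‖G i - F‖ ^ 2 * ρ :=
      ((P' - P - expVariation F δ (G i - F)).le_opNorm _).trans (by
        gcongr
        exact norm_exp_sub_exp_sub_variation_le hF (hG i) hδ)
    have h1 : P' a - P b = P' (a - b) + (P' - P) b := by simp
    have h2 : inner ℝ (P' (a - b)) ((P' - P) b) =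
        inner ℝ ((P' - P) (a - b)) ((P' - P) b) +
        inner ℝ (P (a - b)) ((P' - P - expVariation F δ (G i - F)) b) +
        inner ℝ (P (a - b)) (expVariation F δ (G i - F) b) := by
      rw [add_assoc, ← inner_add_right, sub_apply _ (expVariation _ _ _),
        sub_add_cancel, ← inner_add_left, sub_apply P' P (a - b), sub_add_cancel]
    have h3 : inner ℝ ((P' - P) (a - b)) ((P' - P) b) ≤
        (δ * ‖G i - F‖ * (2 * ρ)) * (δ * ‖G i - F‖ * ρ) :=
      (real_inner_le_norm _ _).trans (mul_le_mul hDe hDb (norm_nonneg _) (by positivity))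
    have h4 : inner ℝ (P (a - b)) ((P' - P - expVariation F δ (G i - F)) b) ≤
        (2 * ρ) * (δ ^ 2 * ‖G i - F‖ ^ 2 * ρ) :=
      (real_inner_le_norm _ _).trans (mul_le_mul hP hV (norm_nonneg _) (by positivity))
    have h5 : ‖P' (a - b)‖ ^ 2 ≤ ‖a - b‖ ^ 2 := by
      gcongr
      exact norm_exp_smul_apply_le (hG i) hδ _
    have h6 : ‖(P' - P) b‖ ^ 2 ≤ (δ * ‖G i - F‖ * ρ) ^ 2 := by gcongr
    rw [h1, norm_add_sq_real, h2]
    nlinarith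
  -- Here unbiasedness enters: P(a - b) and b do not depend on i, so the mean acts on the variation
  -- alone.
  have hzero : ∑ i, p i * inner ℝ (P (a - b)) (expVariation F δ (G i - F) b) = 0 := by
    have h : ∑ i, p i • expVariation F δ (G i - F) = 0 := by
      rw [sum_smul_expVariation]
      simp [smul_sub, hmean, ← Finset.sum_smul, hp1, expVariation]
    have h' := congrArg (fun X : E →L[ℝ] E => inner ℝ (P (a - b)) (X b)) h
    simpa [inner_sum, inner_smul_right, sum_apply] using h'
  calc _ ≤ ∑ i, p i * (‖a - b‖ ^ 2 + 9 * ρ ^ 2 * δ ^ 2 * ‖G i - F‖ ^ 2 +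
        2 * inner ℝ (P (a - b)) (expVariation F δ (G i - F) b)) :=
        Finset.sum_le_sum fun i _ => mul_le_mul_of_nonneg_left (hstep i) (hp i)
    _ = (∑ i, p i) * ‖a - b‖ ^ 2 + 9 * ρ ^ 2 * δ ^ 2 * (∑ i, p i * ‖G i - F‖ ^ 2) +
        2 * ∑ i, p i * inner ℝ (P (a - b)) (expVariation F δ (G i - F) b) := by
      simp only [Finset.sum_mul, Finset.mul_sum, ← Finset.sum_add_distrib]
      exact Finset.sum_congr rfl fun i _ => by ring
    _ = _ := by rw [hzero, hp1]; ring

/-! ### Products of exponentials -/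

/-- The product `exp (δ_{K-1} G_{K-1}) ⋯ exp (δ_0 G_0)`. -/
def evol : (K : ℕ) → (Fin K → ℝ) → (Fin K → E →L[ℝ] E) → E →L[ℝ] E
  | 0, _, _ => 1
  | K + 1, δ, G => evol K (Fin.tail δ) (Fin.tail G) * NormedSpace.exp (δ 0 • G 0)

theorem norm_evol_le_one : ∀ {K : ℕ} {δ : Fin K → ℝ} {G : Fin K → E →L[ℝ] E},
    (∀ k, 0 ≤ δ k) → (∀ k x, inner ℝ x (G k x) ≤ 0) → ‖evol K δ G‖ ≤ 1
  | 0, _, _, _, _ => ContinuousLinearMap.norm_id_le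
  | K + 1, δ, G, hδ, hG => by
    refine (norm_mul_le _ _).trans (mul_le_one₀ ?_ (norm_nonneg _) ?_)
    · exact norm_evol_le_one (fun k => hδ k.succ) fun k => hG k.succ
    · exact norm_exp_smul_le_one (hG 0) (hδ 0)

/-- Splits the exponential of the mean generator along the grid, so that it can be compared with the
random product factor by factor. -/
theorem evol_const : ∀ {K : ℕ} (δ : Fin K → ℝ) (F : E →L[ℝ] E),
    evol K δ (fun _ => F) = NormedSpace.exp ((∑ k, δ k) • F)
  | 0, _, _ => by simp [evol]
  | K + 1, δ, F => by
    let := NormedAlgebra.restrictScalars ℚ ℝ (E →L[ℝ] E)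
    have h := evol_const (Fin.tail δ) F
    have h0 : evol (K + 1) δ (fun _ => F) =
      evol K (Fin.tail δ) (fun _ => F) * NormedSpace.exp (δ 0 • F) := rfl
    rw [h0, h, ← NormedSpace.exp_add_of_commute (((Commute.refl F).smul_left _).smul_right _),
      ← add_smul, Fin.sum_univ_succ, add_comm]
    rfl

theorem continuous_evol {X : Type*} [TopologicalSpace X] : ∀ {K : ℕ} {δ : X → Fin K → ℝ}
    (G : Fin K → E →L[ℝ] E), Continuous δ → Continuous fun x => evol K (δ x) G
  | 0, _, _, _ => continuous_const
  | K + 1, δ, G, hδ => by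
    have h0 : Continuous fun x => Fin.tail (δ x) :=
      continuous_pi fun k => (continuous_apply k.succ).comp hδ
    have h1 : Continuous fun x => δ x 0 := (continuous_apply 0).comp hδ
    exact (continuous_evol (Fin.tail G) h0).mul
      (continuous_exp_clm.comp (h1.smul continuous_const))

/-- Independence, in the form of conditioning on the first choice. -/
theorem sum_prod_cons {ι : Type*} [Fintype ι] (K : ℕ) (p : ι → ℝ) (X : (Fin (K + 1) → ι) → ℝ) :
    ∑ ω, X ω * ∏ k, p (ω k) =
      ∑ i, p i * ∑ ω : Fin K → ι, X (Fin.cons i ω) * ∏ k, p (ω k) := by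
  rw [← (Fin.consEquiv fun _ => ι).sum_comp, Fintype.sum_prod_type]
  refine Finset.sum_congr rfl fun i _ => ?_
  rw [Finset.mul_sum]
  refine Finset.sum_congr rfl fun ω _ => ?_
  simp [Fin.consEquiv, Fin.prod_univ_succ]
  ring

theorem sum_prod_eq_one {ι : Type*} [Fintype ι] {p : ι → ℝ} (hp1 : ∑ i, p i = 1) :
    ∀ K : ℕ, ∑ ω : Fin K → ι, ∏ k, p (ω k) = 1
  | 0 => by simp
  | K + 1 => by
    have h := sum_prod_cons K p fun _ => 1
    simpa [sum_prod_eq_one hp1 K, hp1] using h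

/-- The mean squared error of a product of exponentials of independent random generators. -/
theorem sum_norm_sq_evol_le {ι : Type*} [Fintype ι] {p : ι → ℝ} (hp : ∀ i, 0 ≤ p i)
    (hp1 : ∑ i, p i = 1) {F : E →L[ℝ] E} {G : ι → E →L[ℝ] E} (hF : ∀ x, inner ℝ x (F x) ≤ 0)
    (hG : ∀ i x, inner ℝ x (G i x) ≤ 0) (hmean : ∑ i, p i • G i = F) {ρ : ℝ} :
    ∀ {K : ℕ} {δ : Fin K → ℝ}, (∀ k, 0 ≤ δ k) → ∀ {a b : E}, ‖a‖ ≤ ρ → ‖b‖ ≤ ρ →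
    ∑ ω : Fin K → ι, ‖evol K δ (fun k => G (ω k)) a - evol K δ (fun _ => F) b‖ ^ 2 *
        ∏ k, p (ω k) ≤
      ‖a - b‖ ^ 2 + 9 * ρ ^ 2 * (∑ k, δ k ^ 2) * ∑ i, p i * ‖G i - F‖ ^ 2
  | 0, δ, _, a, b, _, _ => by simp [evol]
  | K + 1, δ, hδ, a, b, ha, hb => by
    rw [sum_prod_cons, Fin.sum_univ_succ]
    -- After the first choice is fixed, the remaining steps start from two new vectors, still of
    -- norm at most ρ by contractivity. This is why the induction needs distinct initial vectors a
    -- and b.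
    have ih : ∀ i, ∑ ω : Fin K → ι,
        ‖evol (K + 1) δ (fun k => G ((Fin.cons i ω : Fin (K + 1) → ι) k)) a -
          evol (K + 1) δ (fun _ => F) b‖ ^ 2 * ∏ k, p (ω k) ≤
        ‖NormedSpace.exp (δ 0 • G i) a - NormedSpace.exp (δ 0 • F) b‖ ^ 2 +
          9 * ρ ^ 2 * (∑ k : Fin K, δ k.succ ^ 2) * ∑ i, p i * ‖G i - F‖ ^ 2 := fun i => by
      have e1 : ∀ ω : Fin K → ι, evol (K + 1) δ (fun k => G ((Fin.cons i ω : Fin (K + 1) → ι) k)) =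
        evol K (Fin.tail δ) (fun k => G (ω k)) * NormedSpace.exp (δ 0 • G i) := fun ω => rfl
      have e2 : evol (K + 1) δ (fun _ => F) =
        evol K (Fin.tail δ) (fun _ => F) * NormedSpace.exp (δ 0 • F) := rfl
      simp only [e1, e2, mul_apply_eq_comp]
      exact sum_norm_sq_evol_le hp hp1 hF hG hmean (δ := Fin.tail δ) (fun k => hδ k.succ)
        ((norm_exp_smul_apply_le (hG i) (hδ 0) a).trans ha)
        ((norm_exp_smul_apply_le hF (hδ 0) b).trans hb)
    refine (Finset.sum_le_sum fun i _ => mul_le_mul_of_nonneg_left (ih i) (hp i)).trans ?_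
    have hs := sum_norm_sq_step_le hp hp1 hF hG hmean (hδ 0) ha hb
    simp only [mul_add, Finset.sum_add_distrib, ← Finset.sum_mul, hp1]
    linarith

end Exponential

/-! ### Variation of constants -/

section VariationOfConstants

variable {E : Type*} [NormedAddCommGroup E] [NormedSpace ℝ E]

theorem integrable_clm_apply_prod {μ ν : Measure ℝ} [SFinite μ] [SFinite ν] {K : ℝ → E →L[ℝ] E}
    {g : ℝ → E} (hK : Integrable K ν) (hg : Integrable g μ) :
    Integrable (fun z : ℝ × ℝ => K z.2 (g z.1)) (μ.prod ν) := by
  have hm : AEStronglyMeasurable (fun z : ℝ × ℝ => K z.2 (g z.1)) (μ.prod ν) :=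
    (ContinuousLinearMap.apply ℝ E).flip.aestronglyMeasurable_comp₂
      hK.aestronglyMeasurable.comp_snd hg.aestronglyMeasurable.comp_fst
  refine (hg.norm.mul_prod hK.norm).mono' hm (Filter.Eventually.of_forall fun z => ?_)
  rw [mul_comm]
  exact (K z.2).le_opNorm _

/-- Fubini's theorem on a triangle. -/
theorem integral_triangle_swap {t : ℝ} (ht : 0 ≤ t) {K : ℝ → E →L[ℝ] E} {g : ℝ → E}
    (hK : IntervalIntegrable K volume 0 t) (hg : IntervalIntegrable g volume 0 t) :
    ∫ s in (0 : ℝ)..t, ∫ r in s..t, K r (g s) = ∫ r in (0 : ℝ)..t, ∫ s in (0 : ℝ)..r, K r (g s) := by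
  rw [intervalIntegrable_iff_integrableOn_Ioc_of_le ht] at hK hg
  -- The triangle is an indicator on the square, where the product bound gives integrability.
  have hint : Integrable ({z : ℝ × ℝ | z.1 ≤ z.2}.indicator fun z => K z.2 (g z.1))
      ((volume.restrict (Ioc 0 t)).prod (volume.restrict (Ioc 0 t))) :=
    (integrable_clm_apply_prod hK hg).indicator (measurableSet_le measurable_fst measurable_snd)
  have hswap := integral_integral_swap
    (f := fun s r => ({z : ℝ × ℝ | z.1 ≤ z.2}.indicator (fun z => K z.2 (g z.1)) (s, r))) hint
  rw [intervalIntegral.integral_of_le ht, intervalIntegral.integral_of_le ht]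
  have h1 : ∀ s ∈ Ioc 0 t, ∫ r in s..t, K r (g s) = ∫ r in Ioc 0 t,
      ({z : ℝ × ℝ | z.1 ≤ z.2}.indicator (fun z => K z.2 (g z.1)) (s, r)) := by
    intro s hs
    have : (fun r => ({z : ℝ × ℝ | z.1 ≤ z.2}.indicator (fun z => K z.2 (g z.1)) (s, r))) =
        (Ici s).indicator fun r => K r (g s) := by
      funext r; by_cases h : s ≤ r <;> simp [h]
    rw [this, setIntegral_indicator measurableSet_Ici, intervalIntegral.integral_of_le hs.2,
      ← integral_Icc_eq_integral_Ioc]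
    congr 2
    ext r
    simp only [mem_Icc, mem_inter_iff, mem_Ioc, mem_Ici]
    have := hs.1
    constructor <;> rintro ⟨h, h'⟩ <;> grind
  have h2 : ∀ r ∈ Ioc 0 t, ∫ s in (0 : ℝ)..r, K r (g s) = ∫ s in Ioc 0 t,
      ({z : ℝ × ℝ | z.1 ≤ z.2}.indicator (fun z => K z.2 (g z.1)) (s, r)) := by
    intro r hr
    have : (fun s => ({z : ℝ × ℝ | z.1 ≤ z.2}.indicator (fun z => K z.2 (g z.1)) (s, r))) =
        (Iic r).indicator fun s => K r (g s) := by
      funext s; by_cases h : s ≤ r <;> simp [h]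
    rw [this, setIntegral_indicator measurableSet_Iic, intervalIntegral.integral_of_le hr.1.le]
    congr 2
    ext s
    simp only [mem_inter_iff, mem_Ioc, mem_Iic]
    have := hr.2
    grind
  rw [setIntegral_congr_fun measurableSet_Ioc h1, setIntegral_congr_fun measurableSet_Ioc h2]
  exact hswap

theorem intervalIntegrable_clm_apply {t : ℝ} (ht : 0 ≤ t) {H : ℝ → E →L[ℝ] E} {g : ℝ → E}
    (hH : ContinuousOn H (Icc 0 t)) (hg : IntervalIntegrable g volume 0 t) :
    IntervalIntegrable (fun s => H s (g s)) volume 0 t := by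
  rw [intervalIntegrable_iff_integrableOn_Icc_of_le ht] at hg ⊢
  obtain ⟨C, hC⟩ := isCompact_Icc.exists_bound_of_continuousOn hH
  have hm : AEStronglyMeasurable (fun s => H s (g s)) (volume.restrict (Icc 0 t)) :=
    (ContinuousLinearMap.apply ℝ E).flip.aestronglyMeasurable_comp₂
      (hH.aestronglyMeasurable measurableSet_Icc) hg.aestronglyMeasurable
  refine (hg.norm.const_mul C).mono' hm ?_
  filter_upwards [ae_restrict_mem measurableSet_Icc] with s hs
  exact ((H s).le_opNorm _).trans (by gcongr; exact hC s hs)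

theorem intervalIntegrable_clm_apply_of_continuousOn {t : ℝ} (ht : 0 ≤ t) {K : ℝ → E →L[ℝ] E}
    {x : ℝ → E} (hK : IntervalIntegrable K volume 0 t) (hx : ContinuousOn x (Icc 0 t)) :
    IntervalIntegrable (fun s => K s (x s)) volume 0 t := by
  rw [intervalIntegrable_iff_integrableOn_Icc_of_le ht] at hK ⊢
  obtain ⟨C, hC⟩ := isCompact_Icc.exists_bound_of_continuousOn hx
  have hm : AEStronglyMeasurable (fun s => K s (x s)) (volume.restrict (Icc 0 t)) :=
    (ContinuousLinearMap.apply ℝ E).flip.aestronglyMeasurable_comp₂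
      hK.aestronglyMeasurable (hx.aestronglyMeasurable measurableSet_Icc)
  refine (hK.norm.mul_const C).mono' hm ?_
  filter_upwards [ae_restrict_mem measurableSet_Icc] with s hs
  exact ((K s).le_opNorm _).trans (by gcongr; exact hC s hs)

variable [CompleteSpace E]

/-- Integration by parts for an absolutely continuous operator applied to an absolutely continuous
vector. -/
theorem clm_apply_eq_add_integral {t : ℝ} (ht : 0 ≤ t) {H K : ℝ → E →L[ℝ] E} {g x : ℝ → E}
    {x₀ : E} (hH : ContinuousOn H (Icc 0 t)) (hK : IntervalIntegrable K volume 0 t)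
    (hHK : ∀ s ∈ Icc 0 t, H t - H s = ∫ r in s..t, K r)
    (hg : IntervalIntegrable g volume 0 t) (hx : ContinuousOn x (Icc 0 t))
    (hxg : ∀ s ∈ Icc 0 t, x s = x₀ + ∫ r in (0 : ℝ)..s, g r) :
    H t (x t) = H 0 x₀ + ∫ s in (0 : ℝ)..t, (H s (g s) + K s (x s)) := by
  have h0 : (0 : ℝ) ∈ Icc 0 t := ⟨le_rfl, ht⟩
  -- The double integral of K(r) g(s) over s ≤ r is evaluated in both orders: integrating K first
  -- produces H t - H s, integrating g first produces x r - x₀. Equating them is the integration by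
  -- parts, with no derivative of H or x.
  have h1 : ∫ s in (0 : ℝ)..t, ∫ r in s..t, K r (g s) =
      ∫ s in (0 : ℝ)..t, (H t (g s) - H s (g s)) := by
    refine intervalIntegral.integral_congr fun s hs => ?_
    rw [uIcc_of_le ht] at hs
    have hKs : IntervalIntegrable K volume s t :=
      hK.mono_set (by rw [uIcc_of_le ht, uIcc_of_le hs.2]; exact Icc_subset_Icc hs.1 le_rfl)
    rw [← sub_apply, hHK s hs, ContinuousLinearMap.intervalIntegral_apply hKs]
  have h2 : ∫ r in (0 : ℝ)..t, ∫ s in (0 : ℝ)..r, K r (g s) =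
      ∫ r in (0 : ℝ)..t, (K r (x r) - K r x₀) := by
    refine intervalIntegral.integral_congr fun r hr => ?_
    rw [uIcc_of_le ht] at hr
    have hgr : IntervalIntegrable g volume 0 r :=
      hg.mono_set (by rw [uIcc_of_le ht, uIcc_of_le hr.1]; exact Icc_subset_Icc le_rfl hr.2)
    rw [ContinuousLinearMap.intervalIntegral_comp_comm _ hgr, ← map_sub, hxg r hr,
      add_sub_cancel_left]
  have h3 := integral_triangle_swap ht hK hg
  have hHg := intervalIntegrable_clm_apply ht hH hg
  have hKx := intervalIntegrable_clm_apply_of_continuousOn ht hK hx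
  have hKx0 := intervalIntegrable_clm_apply_of_continuousOn ht hK
    (continuousOn_const (c := x₀) (s := Icc 0 t))
  have hHtg : IntervalIntegrable (fun s => H t (g s)) volume 0 t :=
    intervalIntegrable_clm_apply ht (H := fun _ => H t) continuousOn_const hg
  rw [h1, h2, intervalIntegral.integral_sub hHtg hHg, intervalIntegral.integral_sub hKx hKx0,
    ContinuousLinearMap.intervalIntegral_comp_comm _ hg,
    ← ContinuousLinearMap.intervalIntegral_apply hK, ← hHK 0 h0] at h3
  rw [intervalIntegral.integral_add hHg hKx, hxg t ⟨ht, le_rfl⟩, map_add]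
  rw [sub_apply, ← sub_eq_zero] at h3
  rw [← sub_eq_zero, ← h3]
  abel

end VariationOfConstants

/-- The variation of constants formula, for the backward evolution `H s = Φ(t, s)`. -/
theorem IsSolution.eq_variation_of_constants {N : ℕ} {T : ℝ} {𝒜 : ℝ → Matrix (Fin N) (Fin N) ℝ}
    {f : ℝ → Vec N} {x₀ : Vec N} {x : ℝ → Vec N} (hx : IsSolution T 𝒜 f x₀ x)
    (h𝒜 : StronglyMeasurable fun s => op (𝒜 s)) {L : ℝ} (hL : ∀ s, ‖op (𝒜 s)‖ ≤ L)
    (hf : IntegrableOn f (Icc 0 T)) {t : ℝ} (ht : t ∈ Icc 0 T) {H : ℝ → Vec N →L[ℝ] Vec N}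
    (hH : Continuous H) (hHt : H t = 1) {S : Set ℝ} (hS : S.Countable)
    (hd : ∀ s ∈ Ioo 0 t \ S, HasDerivAt H (-(H s * op (𝒜 s))) s) :
    x t = H 0 x₀ + ∫ s in (0 : ℝ)..t, H s (f s) := by
  have hsub : Icc 0 t ⊆ Icc 0 T := Icc_subset_Icc le_rfl ht.2
  have hG : IntervalIntegrable (fun s => op (𝒜 s)) volume 0 t := by
    rw [intervalIntegrable_iff_integrableOn_Icc_of_le ht.1]
    exact Measure.integrableOn_of_bounded (M := L) (by simp) h𝒜.aestronglyMeasurable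
      (Filter.Eventually.of_forall hL)
  have hK : IntervalIntegrable (fun s => -(H s * op (𝒜 s))) volume 0 t := by
    have := hG.continuousOn_mul (f := fun s => op (𝒜 s)) (g := H) hH.continuousOn
    exact this.neg
  have hf' : IntervalIntegrable f volume 0 t := by
    rw [intervalIntegrable_iff_integrableOn_Icc_of_le ht.1]
    exact hf.mono_set hsub
  have hGx := intervalIntegrable_clm_apply_of_continuousOn ht.1 hG (hx.1.mono hsub)
  -- With derivative -H𝒜 for H and 𝒜x + f for x, the terms containing x cancel and only H f remains.
  have h := clm_apply_eq_add_integral ht.1 hH.continuousOn hK (g := fun s => op (𝒜 s) (x s) + f s)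
    (x₀ := x₀) (fun s hs => ?_) (hGx.add hf') (hx.1.mono hsub) fun s hs => hx.2 s (hsub hs)
  · rw [hHt] at h
    simpa using h
  · refine (integral_eq_of_hasDerivAt_off_countable_of_le H _ hs.2 hS hH.continuousOn
      (fun r hr => hd r ⟨⟨hs.1.trans_lt hr.1.1, hr.1.2⟩, hr.2⟩) ?_).symm
    exact hK.mono_set (by rw [uIcc_of_le ht.1, uIcc_of_le hs.2]; exact Icc_subset_Icc hs.1 le_rfl)

/-! ### The evolution of the randomized dynamics -/

/-- The length of the part of the `k`-th grid interval that lies in `[s, t]`. -/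
def stepLength {K : ℕ} (τ : Fin (K + 1) → ℝ) (t s : ℝ) (k : Fin K) : ℝ :=
  max s (min t (τ k.succ)) - max s (min t (τ k.castSucc))

theorem stepLength_nonneg {K : ℕ} {τ : Fin (K + 1) → ℝ} (hτ : Monotone τ) (t s : ℝ) (k : Fin K) :
    0 ≤ stepLength τ t s k :=
  sub_nonneg.2 (max_le_max le_rfl (min_le_min le_rfl (hτ (Fin.castSucc_le_succ k))))

theorem stepLength_le {K : ℕ} {τ : Fin (K + 1) → ℝ} (hτ : Monotone τ) (t s : ℝ) (k : Fin K) :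
    stepLength τ t s k ≤ τ k.succ - τ k.castSucc := by
  have := hτ (Fin.castSucc_le_succ k)
  unfold stepLength
  grind

/-- Clamping the grid points to [s, t] makes the sum telescope; for t < s every length vanishes. -/
theorem sum_stepLength {K : ℕ} (τ : Fin (K + 1) → ℝ) (t s : ℝ) :
    ∑ k, stepLength τ t s k = max s (min t (τ (Fin.last K))) - max s (min t (τ 0)) := by
  induction K with
  | zero => simp
  | succ K ih =>
    have h : ∀ k : Fin K, stepLength τ t s k.succ = stepLength (Fin.tail τ) t s k := fun _ => rfl
    rw [Fin.sum_univ_succ, Finset.sum_congr rfl fun k _ => h k, ih]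
    simp [stepLength, Fin.tail]

theorem continuous_stepLength {K : ℕ} (τ : Fin (K + 1) → ℝ) :
    Continuous fun z : ℝ × ℝ => stepLength τ z.1 z.2 := by
  unfold stepLength
  fun_prop

/-- Only the factor whose interval contains s varies with s: later lengths are locally constant and
earlier ones are zero. That factor is thus the rightmost nontrivial one, so its generator appears on
the right. The recursion peels off the first interval. -/
theorem hasDerivAt_evol_stepLength {E : Type*} [NormedAddCommGroup E] [InnerProductSpace ℝ E]
    [CompleteSpace E] {t : ℝ} : ∀ {K : ℕ} {τ : Fin (K + 1) → ℝ}
    (_ : Monotone τ) (G : Fin K → E →L[ℝ] E) {s : ℝ}, τ 0 < s → s < t →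
    t ≤ τ (Fin.last K) → s ∉ range τ →
    HasDerivAt (fun s => evol K (stepLength τ t s) G) (-(evol K (stepLength τ t s) G *
      ∑ k : Fin K, (Ico (τ k.castSucc) (τ k.succ)).indicator (fun _ => G k) s)) s
  | 0, τ, _, G, s, h0, h1, h2, _ => absurd (h0.trans h1) (not_lt.2 h2)
  | K + 1, τ, hτ, G, s, h0, h1, h2, h3 => by
    have hτ' : Monotone (Fin.tail τ) := fun i j hij => hτ (Fin.succ_le_succ_iff.2 hij)
    have hne : s ≠ τ 1 := fun h => h3 ⟨1, h.symm⟩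
    have hstep0 : ∀ r, stepLength τ t r 0 = max r (min t (τ 1)) - max r (min t (τ 0)) :=
      fun _ => rfl
    -- If s lies in the first interval, the other factors are frozen and one exponential is
    -- differentiated; otherwise the first factor is the identity near s and the shorter grid takes
    -- over.
    rcases hne.lt_or_gt with hlt | hgt
    · have hev : (fun r => evol (K + 1) (stepLength τ t r) G) =ᶠ[nhds s] fun r =>
          evol K (stepLength (Fin.tail τ) t s) (Fin.tail G) *
            NormedSpace.exp ((min t (τ 1) - r) • G 0) := by
        filter_upwards [Ioo_mem_nhds h0 (lt_min h1 hlt)] with r hr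
        have e1 : evol (K + 1) (stepLength τ t r) G =
          evol K (stepLength (Fin.tail τ) t r) (Fin.tail G) *
            NormedSpace.exp (stepLength τ t r 0 • G 0) := rfl
        have e2 : ∀ r < min t (τ 1), stepLength (Fin.tail τ) t r =
            fun k => min t (Fin.tail τ k.succ) - min t (Fin.tail τ k.castSucc) := by
          intro r hr
          funext k
          have hk : ∀ j : Fin (K + 1), r ≤ min t (Fin.tail τ j) := fun j =>
            hr.le.trans (min_le_min le_rfl (hτ (by simp [Fin.le_def])))
          simp only [stepLength, max_eq_right (hk _)]
        rw [e1, e2 r hr.2, e2 s (lt_min h1 hlt), hstep0, max_eq_right hr.2.le,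
          max_eq_left ((min_le_right _ _).trans hr.1.le)]
      have hsum : ∑ k : Fin (K + 1), (Ico (τ k.castSucc) (τ k.succ)).indicator (fun _ => G k) s =
          G 0 := by
        rw [Fin.sum_univ_succ, Finset.sum_eq_zero, add_zero, indicator_of_mem]
        · exact ⟨h0.le, hlt⟩
        · intro k _
          refine indicator_of_notMem (fun h => ?_) _
          exact absurd (h.1.trans_lt hlt) (not_lt.2 (hτ (by simp [Fin.le_def])))
      rw [hsum, hev.eq_of_nhds]
      refine HasDerivAt.congr_of_eventuallyEq ?_ hev
      have h4 : HasDerivAt (fun r : ℝ => NormedSpace.exp ((min t (τ 1) - r) • G 0))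
          (-(NormedSpace.exp ((min t (τ 1) - s) • G 0) * G 0)) s := by
        have := (hasDerivAt_exp_smul (G 0) (min t (τ 1) - s)).scomp s
          ((hasDerivAt_id s).const_sub (min t (τ 1)))
        simpa [Function.comp_def] using this
      convert! h4.const_mul (evol K (stepLength (Fin.tail τ) t s) (Fin.tail G)) using 1
      noncomm_ring
    · have hev : (fun r => evol (K + 1) (stepLength τ t r) G) =ᶠ[nhds s] fun r =>
          evol K (stepLength (Fin.tail τ) t r) (Fin.tail G) := by
        filter_upwards [Ioi_mem_nhds hgt] with r hr
        have e1 : evol (K + 1) (stepLength τ t r) G =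
          evol K (stepLength (Fin.tail τ) t r) (Fin.tail G) *
            NormedSpace.exp (stepLength τ t r 0 • G 0) := rfl
        have hr0 : τ 0 ≤ r := (hτ (Fin.zero_le 1)).trans (le_of_lt hr)
        rw [e1, hstep0, max_eq_left ((min_le_right _ _).trans (le_of_lt hr)),
          max_eq_left ((min_le_right _ _).trans hr0), sub_self, zero_smul,
          NormedSpace.exp_zero, mul_one]
      have hsum : ∑ k : Fin (K + 1), (Ico (τ k.castSucc) (τ k.succ)).indicator (fun _ => G k) s =
          ∑ k : Fin K, (Ico (Fin.tail τ k.castSucc) (Fin.tail τ k.succ)).indicator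
            (fun _ => Fin.tail G k) s := by
        rw [Fin.sum_univ_succ, indicator_of_notMem (fun h => absurd h.2 (not_lt.2 hgt.le)),
          zero_add]
        rfl
      rw [hsum, hev.eq_of_nhds]
      refine HasDerivAt.congr_of_eventuallyEq ?_ hev
      exact hasDerivAt_evol_stepLength hτ' (Fin.tail G) hgt h1 h2 fun ⟨j, hj⟩ => h3 ⟨j.succ, hj⟩

/-! ### Square integrable functions -/

theorem sq_integral_mul_le {X : Type*} [MeasurableSpace X] {μ : Measure X} {f g : X → ℝ}
    (hf0 : ∀ x, 0 ≤ f x) (hg0 : ∀ x, 0 ≤ g x) (hf : MemLp f 2 μ) (hg : MemLp g 2 μ) :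
    (∫ x, f x * g x ∂μ) ^ 2 ≤ (∫ x, f x ^ 2 ∂μ) * ∫ x, g x ^ 2 ∂μ := by
  have h2 : ENNReal.ofReal 2 = 2 := by norm_num
  have h := integral_mul_le_Lp_mul_Lq_of_nonneg Real.HolderConjugate.two_two
    (Filter.Eventually.of_forall hf0) (Filter.Eventually.of_forall hg0)
    (by rwa [h2]) (by rwa [h2])
  simp only [Real.rpow_two, ← Real.sqrt_eq_rpow] at h
  have h0 : 0 ≤ ∫ x, f x * g x ∂μ := integral_nonneg fun x => mul_nonneg (hf0 x) (hg0 x)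
  calc _ ≤ (√(∫ x, f x ^ 2 ∂μ) * √(∫ x, g x ^ 2 ∂μ)) ^ 2 := by gcongr
    _ = _ := by
      rw [mul_pow, Real.sq_sqrt (integral_nonneg fun x => sq_nonneg _),
        Real.sq_sqrt (integral_nonneg fun x => sq_nonneg _)]

theorem integral_norm_sq_eq {n : ℕ} {T : ℝ} (v : L2 T n) :
    ∫ s in Icc 0 T, ‖v s‖ ^ 2 = ‖v‖ ^ 2 := by
  rw [← real_inner_self_eq_norm_sq v, L2.inner_def]
  simp

theorem memLp_of_continuousOn {E : Type*} [NormedAddCommGroup E] {T : ℝ}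
    {f : ℝ → E} (hf : ContinuousOn f (Icc 0 T)) :
    MemLp f 2 (volume.restrict (Icc 0 T)) := by
  obtain ⟨C, hC⟩ := isCompact_Icc.exists_bound_of_continuousOn hf
  refine MemLp.of_bound (hf.aestronglyMeasurable_of_isCompact isCompact_Icc measurableSet_Icc) C ?_
  filter_upwards [ae_restrict_mem measurableSet_Icc] with s hs using hC s hs

theorem integral_add_mul_add_mul {X : Type*} [MeasurableSpace X] {μ : Measure X} {f g k : X → ℝ}
    (hf : Integrable f μ) (hg : Integrable g μ) (hk : Integrable k μ) (c d : ℝ) :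
    ∫ x, (f x + c * g x + d * k x) ∂μ = ∫ x, f x ∂μ + c * ∫ x, g x ∂μ + d * ∫ x, k x ∂μ := by
  have h1 : Integrable (fun x => f x + c * g x) μ := hf.add (hg.const_mul c)
  rw [integral_add h1 (hk.const_mul d), integral_add hf (hg.const_mul c), integral_const_mul,
    integral_const_mul]

theorem integrable_inner_of_memLp {E X : Type*} [NormedAddCommGroup E] [InnerProductSpace ℝ E]
    [MeasurableSpace X] {μ : Measure X} {f g : X → E} (hf : MemLp f 2 μ) (hg : MemLp g 2 μ) :
    Integrable (fun x => inner ℝ (f x) (g x)) μ := by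
  refine (L2.integrable_inner (𝕜 := ℝ) (hf.toLp f) (hg.toLp g)).congr ?_
  filter_upwards [hf.coeFn_toLp, hg.coeFn_toLp] with x h1 h2
  rw [h1, h2]

/-- The Cauchy-Schwarz inequality for the action of an operator kernel on an input. -/
theorem norm_integral_kernel_input_le {N q : ℕ} {T : ℝ} {D : ℝ → Vec N →L[ℝ] Vec N}
    (hD : Continuous D) (B : Matrix (Fin N) (Fin q) ℝ) (v : L2 T q) {m : ℝ} (hm : 0 ≤ m)
    (hDm : ∫ s in Icc 0 T, ‖D s‖ ^ 2 ≤ m ^ 2) {t : ℝ} (ht : t ∈ Icc 0 T) :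
    ‖∫ s in (0 : ℝ)..t, D s (op B (v s))‖ ≤ m * ‖op B‖ * ‖v‖ := by
  have hD2 : MemLp (fun s => ‖D s‖) 2 (volume.restrict (Icc 0 T)) :=
    memLp_of_continuousOn hD.norm.continuousOn
  have hv2 : MemLp (fun s => ‖v s‖) 2 (volume.restrict (Icc 0 T)) := (Lp.memLp v).norm
  have hint : Integrable (fun s => ‖D s‖ * ‖v s‖) (volume.restrict (Icc 0 T)) :=
    hD2.integrable_mul hv2
  have h1 : ‖∫ s in (0 : ℝ)..t, D s (op B (v s))‖ ≤
      ∫ s in Icc 0 T, ‖op B‖ * (‖D s‖ * ‖v s‖) := by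
    rw [intervalIntegral.integral_of_le ht.1]
    have hsub : Ioc 0 t ⊆ Icc 0 T := fun s hs => ⟨hs.1.le, hs.2.trans ht.2⟩
    calc _ ≤ ∫ s in Ioc 0 t, ‖op B‖ * (‖D s‖ * ‖v s‖) := by
          refine norm_integral_le_of_norm_le ((hint.const_mul _).mono_measure
            (Measure.restrict_mono_set _ hsub)) (Filter.Eventually.of_forall fun s => ?_)
          calc _ ≤ ‖D s‖ * (‖op B‖ * ‖v s‖) :=
                ((D s).le_opNorm _).trans (by gcongr; exact (op B).le_opNorm _)
            _ = _ := by ring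
      _ ≤ _ := setIntegral_mono_set (hint.const_mul _)
          (Filter.Eventually.of_forall fun s => by positivity) hsub.eventuallyLE
  rw [integral_const_mul] at h1
  have h2 := sq_integral_mul_le (fun s => norm_nonneg (D s)) (fun s => norm_nonneg (v s)) hD2 hv2
  rw [integral_norm_sq_eq] at h2
  have h3 : ∫ s in Icc 0 T, ‖D s‖ * ‖v s‖ ≤ m * ‖v‖ := by
    refine (le_abs_self _).trans (abs_le_of_sq_le_sq (h2.trans ?_) (by positivity))
    rw [mul_pow]
    gcongr
  calc _ ≤ ‖op B‖ * (m * ‖v‖) := h1.trans (by gcongr)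
    _ = _ := by ring

/-! ### States given by an evolution -/

/-- The response `t ↦ ∫₀ᵗ Φ(t, s) B v(s) ds` to an input. -/
def response {N q : ℕ} {T : ℝ} (Φ : ℝ → ℝ → Vec N →L[ℝ] Vec N) (B : Matrix (Fin N) (Fin q) ℝ)
    (v : L2 T q) (t : ℝ) : Vec N :=
  ∫ s in (0 : ℝ)..t, Φ t s (op B (v s))

/-- `Φ` is a contractive evolution that generates the states of `ẋ = 𝒜(t) x + B u`. -/
structure IsEvolution {N q : ℕ} (T : ℝ) (𝒜 : ℝ → Matrix (Fin N) (Fin N) ℝ)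
    (B : Matrix (Fin N) (Fin q) ℝ) (x₀ : Vec N) (Φ : ℝ → ℝ → Vec N →L[ℝ] Vec N) : Prop where
  continuous : Continuous fun z : ℝ × ℝ => Φ z.1 z.2
  norm_le_one : ∀ t s, ‖Φ t s‖ ≤ 1
  continuousOn_state : ∀ u : L2 T q, ContinuousOn (state T 𝒜 B x₀ u) (Icc 0 T)
  state_eq : ∀ (u : L2 T q), ∀ t ∈ Icc 0 T, state T 𝒜 B x₀ u t = Φ t 0 x₀ + response Φ B u t

theorem response_add_smul {N q : ℕ} {T : ℝ} {Φ : ℝ → ℝ → Vec N →L[ℝ] Vec N}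
    (hΦ : Continuous fun z : ℝ × ℝ => Φ z.1 z.2) (B : Matrix (Fin N) (Fin q) ℝ)
    (u v : L2 T q) (θ : ℝ) {t : ℝ} (ht : t ∈ Icc 0 T) :
    response Φ B (u + θ • v) t = response Φ B u t + θ • response Φ B v t := by
  have hc : Continuous fun s => Φ t s := hΦ.comp (Continuous.prodMk_right t)
  have hi : ∀ w : L2 T q, IntervalIntegrable (fun s => Φ t s (op B (w s))) volume 0 t := by
    intro w
    refine intervalIntegrable_clm_apply ht.1 hc.continuousOn ?_
    rw [intervalIntegrable_iff_integrableOn_Icc_of_le ht.1]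
    exact (integrableOn_input B w).mono_set (Icc_subset_Icc le_rfl ht.2)
  unfold response
  have h : ∫ s in (0 : ℝ)..t, Φ t s (op B ((u + θ • v : L2 T q) s)) =
      ∫ s in (0 : ℝ)..t, (Φ t s (op B (u s)) + θ • Φ t s (op B (v s))) := by
    refine intervalIntegral.integral_congr_ae ?_
    have h1 := Lp.coeFn_add u (θ • v)
    have h2 := Lp.coeFn_smul θ v
    have h3 : ∀ᵐ s ∂volume.restrict (Icc 0 T), (u + θ • v : L2 T q) s = u s + θ • v s := by
      filter_upwards [h1, h2] with s h1 h2
      rw [h1, Pi.add_apply, h2, Pi.smul_apply]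
    rw [ae_restrict_iff' measurableSet_Icc] at h3
    filter_upwards [h3] with s hs hst
    rw [uIoc_of_le ht.1] at hst
    rw [hs ⟨hst.1.le, hst.2.trans ht.2⟩, map_add, map_smul, map_add, map_smul]
  have hv : IntervalIntegrable (fun s => θ • Φ t s (op B (v s))) volume 0 t := (hi v).smul θ
  rw [h, intervalIntegral.integral_add (hi u) hv, intervalIntegral.integral_smul]

section Evolution

variable {N q : ℕ} {T : ℝ} {𝒜 : ℝ → Matrix (Fin N) (Fin N) ℝ} {B : Matrix (Fin N) (Fin q) ℝ}
  {x₀ : Vec N} {Φ : ℝ → ℝ → Vec N →L[ℝ] Vec N}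

theorem IsEvolution.state_add_smul (h : IsEvolution T 𝒜 B x₀ Φ) (u v : L2 T q) (θ : ℝ) {t : ℝ}
    (ht : t ∈ Icc 0 T) :
    state T 𝒜 B x₀ (u + θ • v) t = state T 𝒜 B x₀ u t + θ • response Φ B v t := by
  rw [h.state_eq _ t ht, h.state_eq _ t ht, response_add_smul h.continuous B u v θ ht, add_assoc]

theorem IsEvolution.memLp_response (h : IsEvolution T 𝒜 B x₀ Φ) (v : L2 T q) :
    MemLp (response Φ B v) 2 (volume.restrict (Icc 0 T)) := by
  -- The response is the difference of the states for the controls v and 0, hence continuous on [0,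
  -- T].
  refine memLp_of_continuousOn (ContinuousOn.congr
    ((h.continuousOn_state (0 + (1 : ℝ) • v)).sub (h.continuousOn_state 0)) fun t ht => ?_)
  rw [Pi.sub_apply, h.state_add_smul 0 v 1 ht]
  simp

theorem IsEvolution.norm_response_le (h : IsEvolution T 𝒜 B x₀ Φ) (v : L2 T q) {t : ℝ}
    (ht : t ∈ Icc 0 T) : ‖response Φ B v t‖ ≤ √T * ‖op B‖ * ‖v‖ := by
  have hT : 0 ≤ T := ht.1.trans ht.2
  have hc : Continuous fun s => Φ t s := h.continuous.comp (Continuous.prodMk_right t)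
  -- A contractive kernel has L² norm at most √T on [0, T].
  refine norm_integral_kernel_input_le hc B v (Real.sqrt_nonneg T) ?_ ht
  rw [Real.sq_sqrt hT]
  have := setIntegral_mono_on (μ := volume) (s := Icc 0 T) (f := fun s => ‖Φ t s‖ ^ 2)
    (g := fun _ => (1 : ℝ)) (hc.norm.pow 2).continuousOn.integrableOn_Icc (by simp)
    measurableSet_Icc fun s _ => pow_le_one₀ (norm_nonneg _) (h.norm_le_one t s)
  simpa [hT] using this

theorem IsEvolution.norm_state_le (h : IsEvolution T 𝒜 B x₀ Φ) (u : L2 T q) {t : ℝ}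
    (ht : t ∈ Icc 0 T) : ‖state T 𝒜 B x₀ u t‖ ≤ ‖x₀‖ + √T * ‖op B‖ * ‖u‖ := by
  rw [h.state_eq u t ht]
  refine (norm_add_le _ _).trans (add_le_add ?_ (h.norm_response_le u ht))
  exact ((Φ t 0).le_opNorm _).trans (mul_le_of_le_one_left (norm_nonneg _) (h.norm_le_one t 0))

end Evolution

/-! ### The cost as a quadratic function on lines -/

/-- The symmetric bilinear form `½ (aᵀ Q b + bᵀ Q a)` of the quadratic form `quad Q`. -/
def bilin {n : ℕ} (Q : Matrix (Fin n) (Fin n) ℝ) (a b : Vec n) : ℝ :=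
  (1 / 2) * (inner ℝ a (op Q b) + inner ℝ b (op Q a))

section Bilin

variable {n : ℕ} {Q : Matrix (Fin n) (Fin n) ℝ}

/-- The symmetrized form `bilin` makes this hold for every matrix, so symmetry never enters the
expansion of the cost. -/
theorem quad_add_smul (a b : Vec n) (θ : ℝ) :
    quad Q (a + θ • b) = quad Q a + 2 * θ * bilin Q a b + θ ^ 2 * quad Q b := by
  simp only [quad, bilin, map_add, map_smul, inner_add_left, inner_add_right, inner_smul_left,
    inner_smul_right, RCLike.conj_to_real]
  ring

theorem bilin_sub_bilin_le (a b a' b' : Vec n) :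
    bilin Q a b - bilin Q a' b' ≤ ‖op Q‖ * (‖a‖ * ‖b - b'‖ + ‖a - a'‖ * ‖b'‖) := by
  have h : ∀ c d : Vec n, inner ℝ c (op Q d) ≤ ‖op Q‖ * (‖c‖ * ‖d‖) := fun c d =>
    (real_inner_le_norm _ _).trans (by
      calc _ ≤ ‖c‖ * (‖op Q‖ * ‖d‖) := by gcongr; exact (op Q).le_opNorm _
        _ = _ := by ring)
  have h1 := h a (b - b')
  have h2 := h (b - b') a
  have h3 := h (a - a') b'
  have h4 := h b' (a - a')
  simp only [map_sub, inner_sub_left, inner_sub_right] at h1 h2 h3 h4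
  unfold bilin
  linarith

theorem integrable_bilin {X : Type*} [MeasurableSpace X] {μ : Measure X} {f g : X → Vec n}
    (hf : MemLp f 2 μ) (hg : MemLp g 2 μ) : Integrable (fun x => bilin Q (f x) (g x)) μ :=
  ((integrable_inner_of_memLp hf ((op Q).comp_memLp' hg)).add
    (integrable_inner_of_memLp hg ((op Q).comp_memLp' hf))).const_mul _

theorem integrable_quad {X : Type*} [MeasurableSpace X] {μ : Measure X} {f : X → Vec n}
    (hf : MemLp f 2 μ) : Integrable (fun x => quad Q (f x)) μ :=
  integrable_inner_of_memLp hf ((op Q).comp_memLp' hf)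

end Bilin

section Cost

variable {N q : ℕ} {T : ℝ} {𝒜 : ℝ → Matrix (Fin N) (Fin N) ℝ} {B : Matrix (Fin N) (Fin q) ℝ}
  {x₀ : Vec N} {Φ : ℝ → ℝ → Vec N →L[ℝ] Vec N} {Q : Matrix (Fin N) (Fin N) ℝ}
  {R : Matrix (Fin q) (Fin q) ℝ} {xd : L2 T N}

theorem cost_eq (hT : 0 ≤ T) (u : L2 T q) : cost T 𝒜 B x₀ Q R xd u =
    (1 / 2) * ∫ t in Icc 0 T, (quad Q (state T 𝒜 B x₀ u t - xd t) + quad R (u t)) := by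
  rw [cost, intervalIntegral.integral_of_le hT, integral_Icc_eq_integral_Ioc]

/-- The derivative of the cost at `u` in the direction `v`. -/
def costDeriv (𝒜 : ℝ → Matrix (Fin N) (Fin N) ℝ) (B : Matrix (Fin N) (Fin q) ℝ) (x₀ : Vec N)
    (Φ : ℝ → ℝ → Vec N →L[ℝ] Vec N) (Q : Matrix (Fin N) (Fin N) ℝ)
    (R : Matrix (Fin q) (Fin q) ℝ) (xd : L2 T N) (u v : L2 T q) : ℝ :=
  ∫ t in Icc 0 T, (bilin Q (state T 𝒜 B x₀ u t - xd t) (response Φ B v t) + bilin R (u t) (v t))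

theorem IsEvolution.memLp_state_sub (h : IsEvolution T 𝒜 B x₀ Φ) (u : L2 T q) (xd : L2 T N) :
    MemLp (fun t => state T 𝒜 B x₀ u t - xd t) 2 (volume.restrict (Icc 0 T)) :=
  (memLp_of_continuousOn (h.continuousOn_state u)).sub (Lp.memLp xd)

theorem IsEvolution.integrable_costDeriv (h : IsEvolution T 𝒜 B x₀ Φ) (u v : L2 T q) :
    Integrable (fun t => bilin Q (state T 𝒜 B x₀ u t - xd t) (response Φ B v t) +
      bilin R (u t) (v t)) (volume.restrict (Icc 0 T)) :=
  (integrable_bilin (h.memLp_state_sub u xd) (h.memLp_response v)).add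
    (integrable_bilin (Lp.memLp u) (Lp.memLp v))

/-- The state is affine in the control, so the cost is quadratic on lines. The second coefficient
stays anonymous: it is eliminated later and never estimated. -/
theorem IsEvolution.exists_cost_add_smul (h : IsEvolution T 𝒜 B x₀ Φ) (hT : 0 ≤ T)
    (u v : L2 T q) : ∃ c : ℝ, ∀ θ : ℝ, cost T 𝒜 B x₀ Q R xd (u + θ • v) =
      cost T 𝒜 B x₀ Q R xd u + θ * costDeriv 𝒜 B x₀ Φ Q R xd u v + θ ^ 2 * c := by
  refine ⟨(1 / 2) * ∫ t in Icc 0 T, (quad Q (response Φ B v t) + quad R (v t)), fun θ => ?_⟩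
  have h1 : ∫ t in Icc 0 T, (quad Q (state T 𝒜 B x₀ (u + θ • v) t - xd t) +
        quad R ((u + θ • v : L2 T q) t)) =
      ∫ t in Icc 0 T, ((quad Q (state T 𝒜 B x₀ u t - xd t) + quad R (u t)) +
        (2 * θ) * (bilin Q (state T 𝒜 B x₀ u t - xd t) (response Φ B v t) + bilin R (u t) (v t)) +
        θ ^ 2 * (quad Q (response Φ B v t) + quad R (v t))) := by
    refine integral_congr_ae ?_
    filter_upwards [Lp.coeFn_add u (θ • v), Lp.coeFn_smul θ v,
      ae_restrict_mem measurableSet_Icc] with t h1 h2 ht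
    rw [h.state_add_smul u v θ ht, h1, Pi.add_apply, h2, Pi.smul_apply, quad_add_smul,
      add_sub_right_comm, quad_add_smul]
    ring
  have i1 : Integrable (fun t => quad Q (state T 𝒜 B x₀ u t - xd t) + quad R (u t))
      (volume.restrict (Icc 0 T)) :=
    (integrable_quad (h.memLp_state_sub u xd)).add (integrable_quad (Lp.memLp u))
  have i2 := h.integrable_costDeriv (Q := Q) (R := R) (xd := xd) u v
  have i3 : Integrable (fun t => quad Q (response Φ B v t) + quad R (v t))
      (volume.restrict (Icc 0 T)) :=
    (integrable_quad (h.memLp_response v)).add (integrable_quad (Lp.memLp v))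
  rw [cost_eq hT, cost_eq hT, h1, integral_add_mul_add_mul i1 i2 i3, costDeriv]
  ring

end Cost

/-! ### Minimizers of functions that are quadratic on a line -/

theorem eq_zero_of_forall_nonneg {a c : ℝ} (h : ∀ ε : ℝ, 0 ≤ ε * a + ε ^ 2 * c) : a = 0 := by
  have hc : 0 < |c| + 1 := by positivity
  -- A step against the sign of a, short enough that the value is at most -a² / (|c| + 1)².
  have h1 := h (-a / (|c| + 1))
  have h2 : -a / (|c| + 1) * a + (-a / (|c| + 1)) ^ 2 * c =
      a ^ 2 * (c - |c| - 1) / (|c| + 1) ^ 2 := by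
    field_simp
    ring
  rw [h2, le_div_iff₀ (by positivity), zero_mul] at h1
  have h3 : c ≤ |c| := le_abs_self c
  have h4 : a ^ 2 ≤ 0 := by nlinarith [sq_nonneg a]
  exact pow_eq_zero_iff two_ne_zero |>.1 (le_antisymm h4 (sq_nonneg a))

/-- The distance of the minimizers of two functions, of which one is strongly convex, is
controlled by the difference of the derivatives. -/
theorem mul_norm_sq_le_of_isMinOn {V : Type*} [NormedAddCommGroup V] [NormedSpace ℝ V]
    {f g : V → ℝ} {α : ℝ} (hg : StrongConvexOn univ α g) {u w : V} (hu : IsMinOn f univ u)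
    (hw : IsMinOn g univ w) {a b c d : ℝ}
    (hf' : ∀ θ : ℝ, f (u + θ • (w - u)) = f u + θ * a + θ ^ 2 * c)
    (hg' : ∀ θ : ℝ, g (u + θ • (w - u)) = g u + θ * b + θ ^ 2 * d) :
    α * ‖w - u‖ ^ 2 ≤ a - b := by
  have ha : a = 0 := eq_zero_of_forall_nonneg (c := c) fun ε => by
    have h := isMinOn_iff.1 hu (u + ε • (w - u)) (mem_univ _)
    rw [hf'] at h
    linarith
  have hgw : g w = g u + b + d := by simpa using hg' 1
  -- Stationarity of w: the derivative of g along the line at θ = 1 is b + 2d.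
  have hb : b + 2 * d = 0 := eq_zero_of_forall_nonneg (c := d) fun ε => by
    have h := isMinOn_iff.1 hw (u + (1 + ε) • (w - u)) (mem_univ _)
    rw [hg', hgw] at h
    linarith
  have h2 : (0 : ℝ) ≤ 1 / 2 := by norm_num
  -- For a quadratic function the midpoint suffices: it gives α‖w - u‖²/8 ≤ d/4, and 2d = -b = a -
  -- b.
  have hmid := hg.2 (mem_univ u) (mem_univ w) h2 h2 (add_halves 1)
  have hm : (1 / 2 : ℝ) • u + (1 / 2 : ℝ) • w = u + (1 / 2 : ℝ) • (w - u) := by module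
  rw [hm, hg', hgw, norm_sub_rev] at hmid
  simp only [smul_eq_mul] at hmid
  linarith

/-! ### Comparison of two evolutions -/

/-- The squared size at time `t` of a kernel that acts on initial data and on inputs. -/
def kernelSq {N : ℕ} (T : ℝ) (D : ℝ → ℝ → Vec N →L[ℝ] Vec N) (t : ℝ) : ℝ :=
  ‖D t 0‖ ^ 2 + ∫ s in Icc 0 T, ‖D t s‖ ^ 2

section Kernel

variable {N q : ℕ} {T : ℝ} {D : ℝ → ℝ → Vec N →L[ℝ] Vec N}

theorem kernelSq_nonneg (t : ℝ) : 0 ≤ kernelSq T D t :=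
  add_nonneg (sq_nonneg _) (integral_nonneg fun _ => sq_nonneg _)

theorem continuous_integral_kernel (hT : 0 ≤ T) (hD : Continuous fun z : ℝ × ℝ => D z.1 z.2) :
    Continuous fun t => ∫ s in Icc 0 T, ‖D t s‖ ^ 2 := by
  have h0 : Continuous fun z : ℝ × ℝ => ‖D z.1 z.2‖ ^ 2 := hD.norm.pow 2
  have h := intervalIntegral.continuous_parametric_intervalIntegral_of_continuous' (μ := volume)
    (f := fun t s => ‖D t s‖ ^ 2) h0 0 T
  simpa only [intervalIntegral.integral_of_le hT, ← integral_Icc_eq_integral_Ioc] using h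

theorem continuous_kernelSq (hT : 0 ≤ T) (hD : Continuous fun z : ℝ × ℝ => D z.1 z.2) :
    Continuous (kernelSq T D) :=
  ((hD.comp (Continuous.prodMk_left 0)).norm.pow 2).add (continuous_integral_kernel hT hD)

/-- The finite weighted sum commutes with the time integrals. In `kernelSq` the value at s = 0
contributes c and the integral over s contributes Tc; the outer integral adds the factor T. -/
theorem sum_mul_integral_kernelSq_le {ι : Type*} [Fintype ι] (hT : 0 ≤ T) (w : ι → ℝ)
    {D : ι → ℝ → ℝ → Vec N →L[ℝ] Vec N} (hD : ∀ i, Continuous fun z : ℝ × ℝ => D i z.1 z.2)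
    {c : ℝ} (hc : ∀ t ∈ Icc 0 T, ∀ s ∈ Icc 0 T, ∑ i, ‖D i t s‖ ^ 2 * w i ≤ c) :
    ∑ i, (∫ t in Icc 0 T, kernelSq T (D i) t) * w i ≤ T * (1 + T) * c := by
  have hone : ∀ {f : ℝ → ℝ} {b : ℝ}, IntegrableOn f (Icc 0 T) → (∀ t ∈ Icc 0 T, f t ≤ b) →
      ∫ t in Icc 0 T, f t ≤ T * b := fun {f b} hf hb => by
    have h := setIntegral_mono_on hf (integrable_const b) measurableSet_Icc hb
    simpa [hT] using h
  have hint : ∀ i, IntegrableOn (fun t => kernelSq T (D i) t * w i) (Icc 0 T) := fun i =>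
    ((continuous_kernelSq hT (hD i)).mul continuous_const).continuousOn.integrableOn_Icc
  have h1 : ∑ i, (∫ t in Icc 0 T, kernelSq T (D i) t) * w i =
      ∫ t in Icc 0 T, ∑ i, kernelSq T (D i) t * w i := by
    rw [integral_finsetSum _ fun i _ => hint i]
    exact Finset.sum_congr rfl fun i _ => (integral_mul_const _ _).symm
  rw [h1, mul_assoc]
  refine hone (integrable_finsetSum _ fun i _ => hint i) fun t ht => ?_
  have hint' : ∀ i, IntegrableOn (fun s => ‖D i t s‖ ^ 2 * w i) (Icc 0 T) := fun i =>
    ((((hD i).comp (Continuous.prodMk_right t)).norm.pow 2).mul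
      continuous_const).continuousOn.integrableOn_Icc
  have h2 : ∑ i, kernelSq T (D i) t * w i =
      ∑ i, ‖D i t 0‖ ^ 2 * w i + ∫ s in Icc 0 T, ∑ i, ‖D i t s‖ ^ 2 * w i := by
    rw [integral_finsetSum _ fun i _ => hint' i, ← Finset.sum_add_distrib]
    refine Finset.sum_congr rfl fun i _ => ?_
    rw [kernelSq, add_mul, integral_mul_const]
  rw [h2, add_mul, one_mul]
  exact add_le_add (hc t ht 0 ⟨le_rfl, hT⟩)
    (hone (integrable_finsetSum _ fun i _ => hint' i) fun s hs => hc t ht s hs)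

theorem norm_kernel_zero_le (t : ℝ) : ‖D t 0‖ ≤ √(kernelSq T D t) :=
  Real.le_sqrt_of_sq_le (le_add_of_nonneg_right (integral_nonneg fun _ => sq_nonneg _))

theorem integral_kernel_le (t : ℝ) : ∫ s in Icc 0 T, ‖D t s‖ ^ 2 ≤ √(kernelSq T D t) ^ 2 := by
  rw [Real.sq_sqrt (kernelSq_nonneg t)]
  exact le_add_of_nonneg_left (sq_nonneg _)

end Kernel

section Comparison

variable {N q : ℕ} {T : ℝ} {𝒜 𝒜' : ℝ → Matrix (Fin N) (Fin N) ℝ}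
  {B : Matrix (Fin N) (Fin q) ℝ} {x₀ : Vec N} {Φ Φ' : ℝ → ℝ → Vec N →L[ℝ] Vec N}
  {Q : Matrix (Fin N) (Fin N) ℝ} {R : Matrix (Fin q) (Fin q) ℝ} {xd : L2 T N}

theorem IsEvolution.continuous_sub (h : IsEvolution T 𝒜 B x₀ Φ) (h' : IsEvolution T 𝒜' B x₀ Φ') :
    Continuous fun z : ℝ × ℝ => (Φ - Φ') z.1 z.2 :=
  h.continuous.sub h'.continuous

theorem IsEvolution.response_sub_response (h : IsEvolution T 𝒜 B x₀ Φ)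
    (h' : IsEvolution T 𝒜' B x₀ Φ') (v : L2 T q) {t : ℝ} (ht : t ∈ Icc 0 T) :
    response Φ B v t - response Φ' B v t = response (Φ - Φ') B v t := by
  have hi : IntervalIntegrable (fun s => op B (v s)) volume 0 t := by
    rw [intervalIntegrable_iff_integrableOn_Icc_of_le ht.1]
    exact (integrableOn_input B v).mono_set (Icc_subset_Icc le_rfl ht.2)
  have hc : ∀ {Ψ : ℝ → ℝ → Vec N →L[ℝ] Vec N}, (Continuous fun z : ℝ × ℝ => Ψ z.1 z.2) →
      IntervalIntegrable (fun s => Ψ t s (op B (v s))) volume 0 t := fun {Ψ} hΨ =>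
    intervalIntegrable_clm_apply ht.1
      (hΨ.comp (Continuous.prodMk_right t)).continuousOn hi
  unfold response
  rw [← intervalIntegral.integral_sub (hc h.continuous) (hc h'.continuous)]
  rfl

theorem IsEvolution.norm_response_sub_le (h : IsEvolution T 𝒜 B x₀ Φ)
    (h' : IsEvolution T 𝒜' B x₀ Φ') (v : L2 T q) {t : ℝ} (ht : t ∈ Icc 0 T) :
    ‖response Φ B v t - response Φ' B v t‖ ≤ √(kernelSq T (Φ - Φ') t) * ‖op B‖ * ‖v‖ := by
  rw [h.response_sub_response h' v ht]
  exact norm_integral_kernel_input_le ((h.continuous_sub h').comp (Continuous.prodMk_right t)) B v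
    (Real.sqrt_nonneg _) (integral_kernel_le t) ht

theorem IsEvolution.norm_state_sub_le (h : IsEvolution T 𝒜 B x₀ Φ)
    (h' : IsEvolution T 𝒜' B x₀ Φ') (u : L2 T q) {t : ℝ} (ht : t ∈ Icc 0 T) :
    ‖state T 𝒜 B x₀ u t - state T 𝒜' B x₀ u t‖ ≤
      √(kernelSq T (Φ - Φ') t) * (‖x₀‖ + ‖op B‖ * ‖u‖) := by
  rw [h.state_eq u t ht, h'.state_eq u t ht, add_sub_add_comm]
  refine (norm_add_le _ _).trans ?_
  rw [mul_add, ← mul_assoc]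
  refine add_le_add ?_ (h.norm_response_sub_le h' u ht)
  exact (((Φ - Φ') t 0).le_opNorm x₀).trans
    (mul_le_mul_of_nonneg_right (norm_kernel_zero_le t) (norm_nonneg _))

/-- The weight with which the error of an evolution enters the derivative of the cost. -/
def costWeight (B : Matrix (Fin N) (Fin q) ℝ) (x₀ : Vec N) (Q : Matrix (Fin N) (Fin N) ℝ)
    (xd : L2 T N) (U t : ℝ) : ℝ :=
  ‖op Q‖ * ‖op B‖ * (‖x₀‖ + √T * ‖op B‖ * U + √T * (‖x₀‖ + ‖op B‖ * U) + ‖xd t‖)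

theorem memLp_costWeight (B : Matrix (Fin N) (Fin q) ℝ) (x₀ : Vec N)
    (Q : Matrix (Fin N) (Fin N) ℝ) (xd : L2 T N) (U : ℝ) :
    MemLp (costWeight B x₀ Q xd U) 2 (volume.restrict (Icc 0 T)) := by
  have h1 : MemLp (fun _ : ℝ => ‖x₀‖ + √T * ‖op B‖ * U + √T * (‖x₀‖ + ‖op B‖ * U)) 2
      (volume.restrict (Icc 0 T)) := memLp_const _
  have h2 : MemLp (fun t => ‖xd t‖) 2 (volume.restrict (Icc 0 T)) := (Lp.memLp xd).norm
  exact (h1.add h2).const_mul (‖op Q‖ * ‖op B‖)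

theorem costWeight_nonneg {U : ℝ} (hU : 0 ≤ U) (t : ℝ) : 0 ≤ costWeight B x₀ Q xd U t := by
  unfold costWeight
  positivity

theorem memLp_sqrt_kernelSq (hT : 0 ≤ T) {D : ℝ → ℝ → Vec N →L[ℝ] Vec N}
    (hD : Continuous fun z : ℝ × ℝ => D z.1 z.2) :
    MemLp (fun t => √(kernelSq T D t)) 2 (volume.restrict (Icc 0 T)) :=
  memLp_of_continuousOn (continuous_kernelSq hT hD).sqrt.continuousOn

theorem IsEvolution.costDeriv_sub_le (h : IsEvolution T 𝒜 B x₀ Φ) (h' : IsEvolution T 𝒜' B x₀ Φ')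
    (hT : 0 ≤ T) {u : L2 T q} {U : ℝ} (hu : ‖u‖ ≤ U) (v : L2 T q) :
    costDeriv 𝒜 B x₀ Φ Q R xd u v - costDeriv 𝒜' B x₀ Φ' Q R xd u v ≤
      ‖v‖ * ∫ t in Icc 0 T, √(kernelSq T (Φ - Φ') t) * costWeight B x₀ Q xd U t := by
  have hint : Integrable (fun t => √(kernelSq T (Φ - Φ') t) * costWeight B x₀ Q xd U t)
      (volume.restrict (Icc 0 T)) :=
    (memLp_sqrt_kernelSq hT (h.continuous_sub h')).integrable_mul
      (memLp_costWeight B x₀ Q xd U)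
  rw [costDeriv, costDeriv, ← integral_sub (h.integrable_costDeriv u v)
    (h'.integrable_costDeriv u v), ← integral_const_mul]
  refine setIntegral_mono_on ((h.integrable_costDeriv u v).sub (h'.integrable_costDeriv u v))
    (hint.const_mul _) measurableSet_Icc fun t ht => ?_
  -- The control term is the same for both systems and cancels, so R does not enter the weight.
  rw [add_sub_add_right_eq_sub]
  refine (bilin_sub_bilin_le _ _ _ _).trans ?_
  rw [sub_sub_sub_cancel_right]
  set g := √(kernelSq T (Φ - Φ') t)
  have hg : 0 ≤ g := Real.sqrt_nonneg _
  have hU : 0 ≤ U := (norm_nonneg _).trans hu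
  have h1 : ‖state T 𝒜 B x₀ u t - xd t‖ ≤ ‖x₀‖ + √T * ‖op B‖ * U + ‖xd t‖ :=
    (norm_sub_le _ _).trans (add_le_add_left ((h.norm_state_le u ht).trans (by gcongr)) _)
  have h2 : ‖response Φ B v t - response Φ' B v t‖ ≤ g * ‖op B‖ * ‖v‖ :=
    h.norm_response_sub_le h' v ht
  have h3 : ‖state T 𝒜 B x₀ u t - state T 𝒜' B x₀ u t‖ ≤ g * (‖x₀‖ + ‖op B‖ * U) :=
    (h.norm_state_sub_le h' u ht).trans (by gcongr)
  have h4 : ‖response Φ' B v t‖ ≤ √T * ‖op B‖ * ‖v‖ := h'.norm_response_le v ht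
  calc _ ≤ ‖op Q‖ * ((‖x₀‖ + √T * ‖op B‖ * U + ‖xd t‖) * (g * ‖op B‖ * ‖v‖) +
        g * (‖x₀‖ + ‖op B‖ * U) * (√T * ‖op B‖ * ‖v‖)) := by gcongr
    _ = _ := by rw [costWeight]; ring

/-- The squared distance of the optimal controls of two systems is controlled by the squared
distance of their evolutions. -/
theorem IsEvolution.sq_mul_norm_sub_sq_le (h : IsEvolution T 𝒜 B x₀ Φ)
    (h' : IsEvolution T 𝒜' B x₀ Φ') (hT : 0 ≤ T) {α : ℝ} (hα : 0 ≤ α)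
    (hconv : StrongConvexOn univ α (cost T 𝒜' B x₀ Q R xd)) {u w : L2 T q}
    (hu : IsMinOn (cost T 𝒜 B x₀ Q R xd) univ u) (hw : IsMinOn (cost T 𝒜' B x₀ Q R xd) univ w)
    {U : ℝ} (huU : ‖u‖ ≤ U) :
    α ^ 2 * ‖w - u‖ ^ 2 ≤ (∫ t in Icc 0 T, kernelSq T (Φ - Φ') t) *
      ∫ t in Icc 0 T, costWeight B x₀ Q xd U t ^ 2 := by
  obtain ⟨c, hc⟩ := h.exists_cost_add_smul (Q := Q) (R := R) (xd := xd) hT u (w - u)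
  obtain ⟨d, hd⟩ := h'.exists_cost_add_smul (Q := Q) (R := R) (xd := xd) hT u (w - u)
  -- Both derivatives are taken at u, the minimizer for the first system, so no bound on w is
  -- required.
  have h1 := (mul_norm_sq_le_of_isMinOn hconv hu hw hc hd).trans
    (h.costDeriv_sub_le h' hT huU (w - u))
  have h2 := sq_integral_mul_le (fun t => Real.sqrt_nonneg (kernelSq T (Φ - Φ') t))
    (fun t => costWeight_nonneg (B := B) (x₀ := x₀) (Q := Q) (xd := xd)
      ((norm_nonneg _).trans huU) t)
    (memLp_sqrt_kernelSq hT (h.continuous_sub h')) (memLp_costWeight B x₀ Q xd U)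
  simp only [Real.sq_sqrt (kernelSq_nonneg _)] at h2
  refine le_trans ?_ h2
  rcases (norm_nonneg (w - u)).eq_or_lt with h0 | h0
  · rw [← h0]
    simp [sq_nonneg]
  · have h3 : α * ‖w - u‖ ≤
        ∫ t in Icc 0 T, √(kernelSq T (Φ - Φ') t) * costWeight B x₀ Q xd U t := by
      refine le_of_mul_le_mul_left ?_ h0
      calc _ = α * ‖w - u‖ ^ 2 := by ring
        _ ≤ _ := h1
    rw [← mul_pow]
    gcongr

end Comparison

/-! ### A priori bound for the optimal control -/

theorem quad_eq_dotProduct {n : ℕ} (Q : Matrix (Fin n) (Fin n) ℝ) (y : Vec n) :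
    quad Q y = star y.ofLp ⬝ᵥ (Q.mulVec y.ofLp) := by
  simp [quad, op, EuclideanSpace.inner_eq_star_dotProduct, dotProduct_comm]

theorem quad_nonneg {n : ℕ} {Q : Matrix (Fin n) (Fin n) ℝ} (hQ : Q.PosSemidef) (y : Vec n) :
    0 ≤ quad Q y := by
  rw [quad_eq_dotProduct]
  exact hQ.dotProduct_mulVec_nonneg _

theorem quad_smul {n : ℕ} (Q : Matrix (Fin n) (Fin n) ℝ) (c : ℝ) (y : Vec n) :
    quad Q (c • y) = c ^ 2 * quad Q y := by
  simp only [quad, map_smul, inner_smul_left, inner_smul_right, RCLike.conj_to_real]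
  ring

/-- The minimum over the compact unit sphere is positive and extends by homogeneity. The sphere is
empty exactly in dimension zero. -/
theorem exists_le_quad {n : ℕ} {R : Matrix (Fin n) (Fin n) ℝ} (hR : R.PosDef) :
    ∃ r : ℝ, 0 < r ∧ ∀ y : Vec n, r * ‖y‖ ^ 2 ≤ quad R y := by
  rcases (Metric.sphere (0 : Vec n) 1).eq_empty_or_nonempty with he | hne
  · refine ⟨1, one_pos, fun y => ?_⟩
    have hy : y = 0 := by
      by_contra hy
      have : ‖y‖⁻¹ • y ∈ Metric.sphere (0 : Vec n) 1 := by
        simp [norm_smul, norm_ne_zero_iff.2 hy]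
      simp [he] at this
    simp [hy, quad]
  · have hc : Continuous (quad R) := continuous_id.inner (op R).continuous
    obtain ⟨z, hz, hmin⟩ := (isCompact_sphere (0 : Vec n) 1).exists_isMinOn hne hc.continuousOn
    have hz0 : z ≠ 0 := by
      rintro rfl
      simp at hz
    refine ⟨quad R z, ?_, fun y => ?_⟩
    · rw [quad_eq_dotProduct]
      exact hR.dotProduct_mulVec_pos fun h => hz0 (by ext i; simp [h])
    · rcases eq_or_ne y 0 with rfl | hy
      · simp [quad]
      · have hny : ‖y‖ ≠ 0 := norm_ne_zero_iff.2 hy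
        have h := isMinOn_iff.1 hmin (‖y‖⁻¹ • y) (by simp [norm_smul, hny])
        rw [quad_smul, inv_pow, inv_mul_eq_div, le_div_iff₀ (by positivity)] at h
        exact h

theorem IsEvolution.le_cost {N q : ℕ} {T : ℝ} {𝒜 : ℝ → Matrix (Fin N) (Fin N) ℝ}
    {B : Matrix (Fin N) (Fin q) ℝ} {x₀ : Vec N} {Φ : ℝ → ℝ → Vec N →L[ℝ] Vec N}
    {Q : Matrix (Fin N) (Fin N) ℝ} {R : Matrix (Fin q) (Fin q) ℝ} {xd : L2 T N}
    (h : IsEvolution T 𝒜 B x₀ Φ) (hT : 0 ≤ T) (hQ : Q.PosSemidef) {r : ℝ}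
    (hr : ∀ y, r * ‖y‖ ^ 2 ≤ quad R y) (u : L2 T q) :
    r / 2 * ‖u‖ ^ 2 ≤ cost T 𝒜 B x₀ Q R xd u := by
  rw [cost_eq hT, ← integral_norm_sq_eq]
  have h1 : ∫ t in Icc 0 T, r * ‖u t‖ ^ 2 ≤
      ∫ t in Icc 0 T, (quad Q (state T 𝒜 B x₀ u t - xd t) + quad R (u t)) := by
    refine integral_mono ((Lp.memLp u).norm.integrable_sq.const_mul r)
      ((integrable_quad (h.memLp_state_sub u xd)).add (integrable_quad (Lp.memLp u))) fun t => ?_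
    have := quad_nonneg hQ (state T 𝒜 B x₀ u t - xd t)
    have := hr (u t)
    simp only
    linarith
  rw [integral_const_mul] at h1
  linarith

/-! ### The evolutions of the original and of the randomized dynamics -/

theorem op_sub {m n : ℕ} (A B : Matrix (Fin m) (Fin n) ℝ) : op (A - B) = op A - op B := by
  simp [op]

theorem op_smul {m n : ℕ} (c : ℝ) (A : Matrix (Fin m) (Fin n) ℝ) : op (c • A) = c • op A := by
  simp [op]

theorem zero_smul_clm {E : Type*} [NormedAddCommGroup E] [NormedSpace ℝ E] (G : E →L[ℝ] E) :
    (0 : ℝ) • G = 0 :=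
  zero_smul ℝ G

/-- The evolution of `ẋ = A x`. -/
def constEvolution {N : ℕ} (A : Matrix (Fin N) (Fin N) ℝ) (t s : ℝ) : Vec N →L[ℝ] Vec N :=
  -- The time is the positive part of t - s, so the kernel is continuous and, for dissipative A,
  -- contractive on the whole plane.
  NormedSpace.exp ((max s t - s) • op A)

theorem isEvolution_constEvolution {N q : ℕ} {T : ℝ} (hT : 0 ≤ T) {A : Matrix (Fin N) (Fin N) ℝ}
    (hA : ∀ x : Vec N, inner ℝ x (op A x) ≤ 0) (B : Matrix (Fin N) (Fin q) ℝ) (x₀ : Vec N) :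
    IsEvolution T (fun _ => A) B x₀ (constEvolution A) where
  continuous := continuous_exp_clm.comp (by fun_prop)
  norm_le_one t s := norm_exp_smul_le_one hA (sub_nonneg.2 (le_max_left _ _))
  continuousOn_state u := (state_original hT A B x₀ u).1.1
  state_eq u t ht := by
    refine (state_original hT A B x₀ u).1.eq_variation_of_constants stronglyMeasurable_const
      (fun _ => le_rfl) (integrableOn_input B u) ht (H := constEvolution A t)
      (continuous_exp_clm.comp (by fun_prop)) (by simp [constEvolution, zero_smul_clm]) countable_empty
      fun s hs => ?_
    have h1 : HasDerivAt (fun s : ℝ => NormedSpace.exp ((t - s) • op A))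
        (-(NormedSpace.exp ((t - s) • op A) * op A)) s := by
      have := (hasDerivAt_exp_smul (op A) (t - s)).scomp s ((hasDerivAt_id s).const_sub t)
      simpa [Function.comp_def] using this
    have hev : constEvolution A t =ᶠ[nhds s] fun s : ℝ => NormedSpace.exp ((t - s) • op A) := by
      filter_upwards [Iio_mem_nhds hs.1.2] with r hr
      rw [constEvolution, max_eq_right (le_of_lt hr)]
    rw [hev.eq_of_nhds]
    exact h1.congr_of_eventuallyEq hev

theorem trajectory_eq {N q : ℕ} {T : ℝ} (A : Matrix (Fin N) (Fin N) ℝ)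
    (B : Matrix (Fin N) (Fin q) ℝ) (x₀ : Vec N) (u : L2 T q) {t : ℝ} (ht : 0 ≤ t) :
    trajectory A B x₀ u t = constEvolution A t 0 x₀ + response (constEvolution A) B u t := by
  rw [trajectory, response, constEvolution, max_eq_right ht, sub_zero]
  congr 1
  refine intervalIntegral.integral_congr fun s hs => ?_
  rw [uIcc_of_le ht] at hs
  simp only [constEvolution, max_eq_right hs.2]

theorem evol_eq_one {E : Type*} [NormedAddCommGroup E] [InnerProductSpace ℝ E] [CompleteSpace E] :
    ∀ {K : ℕ} {δ : Fin K → ℝ} (G : Fin K → E →L[ℝ] E), (∀ k, δ k = 0) → evol K δ G = 1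
  | 0, _, _, _ => rfl
  | K + 1, δ, G, hδ => by
    rw [evol, evol_eq_one (δ := Fin.tail δ) _ fun k => hδ k.succ, hδ 0, zero_smul, NormedSpace.exp_zero, one_mul]

/-- The evolution of `ẋ = 𝒜_h(ω, t) x`. -/
def batchEvolution {K M N : ℕ} (Am : Fin M → Matrix (Fin N) (Fin N) ℝ)
    (p : Finset (Fin M) → ℝ) (τ : Fin (K + 1) → ℝ) (ω : Sample K M) (t s : ℝ) :
    Vec N →L[ℝ] Vec N :=
  evol K (stepLength τ t s) fun k => op (batch Am p (ω k))

/-- The coefficients jump only at grid points, a finite set that the variation of constants formula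
tolerates because the evolution stays continuous there. -/
theorem isEvolution_batchEvolution {K M N q : ℕ} {T : ℝ} (hT : 0 ≤ T)
    (Am : Fin M → Matrix (Fin N) (Fin N) ℝ) (p : Finset (Fin M) → ℝ)
    (hdiss : ∀ S (x : Vec N), inner ℝ x (op (batch Am p S) x) ≤ 0)
    {τ : Fin (K + 1) → ℝ} (hτ : Monotone τ) (hτ0 : τ 0 = 0) (hτT : τ (Fin.last K) = T)
    (ω : Sample K M) (B : Matrix (Fin N) (Fin q) ℝ) (x₀ : Vec N) :
    IsEvolution T (batchPath Am p τ ω) B x₀ (batchEvolution Am p τ ω) where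
  continuous := continuous_evol _ (continuous_stepLength τ)
  norm_le_one t s := norm_evol_le_one (stepLength_nonneg hτ t s) fun k => hdiss (ω k)
  continuousOn_state u := (state_batch hT Am p τ ω B x₀ u).1.1
  state_eq u t ht := by
    have hm : StronglyMeasurable fun s => op (batchPath Am p τ ω s) := by
      rw [op_batchPath]
      exact Finset.stronglyMeasurable_fun_sum _ fun k _ =>
        stronglyMeasurable_const.indicator measurableSet_Ico
    have hb : ∀ s, ‖op (batchPath Am p τ ω s)‖ ≤ ∑ k : Fin K, ‖op (batch Am p (ω k))‖ := by
      intro s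
      rw [congrFun (op_batchPath Am p τ ω) s]
      exact (norm_sum_le _ _).trans
        (Finset.sum_le_sum fun k _ => norm_indicator_le_norm_self _ _)
    refine (state_batch hT Am p τ ω B x₀ u).1.eq_variation_of_constants hm hb
      (integrableOn_input B u) ht (H := batchEvolution Am p τ ω t) ?_ ?_
      (finite_range τ).countable fun s hs => ?_
    · exact continuous_evol _ ((continuous_stepLength τ).comp (Continuous.prodMk_right t))
    · exact evol_eq_one _ fun k => by simp [stepLength]
    · rw [congrFun (op_batchPath Am p τ ω) s]
      exact hasDerivAt_evol_stepLength hτ _ (hτ0.trans_lt hs.1.1) hs.1.2 (ht.2.trans hτT.ge) hs.2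

/-! ### The mean squared error of the randomized evolution -/

section Batch

variable {K M N : ℕ} {A : Matrix (Fin N) (Fin N) ℝ} {Am : Fin M → Matrix (Fin N) (Fin N) ℝ}
  {p : Finset (Fin M) → ℝ}

theorem inner_op_batch_nonpos (hdiss : ∀ (m : Fin M) (x : Vec N), inner ℝ x (op (Am m) x) ≤ 0)
    (hπ : ∀ m, 0 < inclProb p m) (S : Finset (Fin M)) (x : Vec N) :
    inner ℝ x (op (batch Am p S) x) ≤ 0 := by
  rw [batch, op_sum, sum_apply, inner_sum]
  refine Finset.sum_nonpos fun m _ => ?_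
  rw [op_smul, smul_apply, inner_smul_right]
  exact mul_nonpos_of_nonneg_of_nonpos (inv_nonneg.2 (hπ m).le) (hdiss m x)

theorem inner_op_sum_nonpos (hA : A = ∑ m, Am m)
    (hdiss : ∀ (m : Fin M) (x : Vec N), inner ℝ x (op (Am m) x) ≤ 0) (x : Vec N) :
    inner ℝ x (op A x) ≤ 0 := by
  rw [hA, op_sum, sum_apply, inner_sum]
  exact Finset.sum_nonpos fun m _ => hdiss m x

/-- The random batches are unbiased. -/
theorem sum_smul_op_batch (hA : A = ∑ m, Am m) (hπ : ∀ m, 0 < inclProb p m) :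
    ∑ S, p S • op (batch Am p S) = op A := by
  have h1 : ∀ S, p S • op (batch Am p S) =
      ∑ m, ((if m ∈ S then p S else 0) * (inclProb p m)⁻¹) • op (Am m) := by
    intro S
    rw [batch, op_sum, Finset.smul_sum, ← Finset.sum_subset (Finset.subset_univ S)]
    · refine Finset.sum_congr rfl fun m hm => ?_
      rw [if_pos hm, op_smul, smul_smul]
    · intro m _ hm
      rw [if_neg hm, zero_mul, zero_smul_clm]
  rw [Finset.sum_congr rfl fun S _ => h1 S, Finset.sum_comm, hA, op_sum]
  refine Finset.sum_congr rfl fun m _ => ?_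
  rw [← Finset.sum_smul, ← Finset.sum_mul]
  -- Collecting the sets S that contain m gives π_m, which cancels the weight 1/π_m.
  change (inclProb p m * (inclProb p m)⁻¹) • op (Am m) = _
  rw [mul_inv_cancel₀ (hπ m).ne', one_smul]

/-- The operator norm is at most the Hilbert-Schmidt norm. The stochastic estimate concerns fixed
vectors; this transfers it to operators at the cost of a factor N. -/
theorem norm_sq_le_sum_norm_sq (D : Vec N →L[ℝ] Vec N) :
    ‖D‖ ^ 2 ≤ ∑ i, ‖D (EuclideanSpace.basisFun (Fin N) ℝ i)‖ ^ 2 := by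
  have h0 : 0 ≤ ∑ i, ‖D (EuclideanSpace.basisFun (Fin N) ℝ i)‖ ^ 2 :=
    Finset.sum_nonneg fun i _ => sq_nonneg _
  rw [← Real.le_sqrt (norm_nonneg D) h0]
  refine D.opNorm_le_bound (Real.sqrt_nonneg _) fun x => ?_
  have h1 : ‖D x‖ ≤ ∑ i, ‖D (EuclideanSpace.basisFun (Fin N) ℝ i)‖ * |x i| := by
    have hx := congrArg D ((EuclideanSpace.basisFun (Fin N) ℝ).sum_repr x)
    rw [← hx, map_sum]
    refine (norm_sum_le _ _).trans (Finset.sum_le_sum fun i _ => ?_)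
    rw [map_smul, norm_smul, mul_comm, EuclideanSpace.basisFun_repr, Real.norm_eq_abs]
  have h2 := Finset.sum_mul_sq_le_sq_mul_sq Finset.univ
    (fun i => ‖D (EuclideanSpace.basisFun (Fin N) ℝ i)‖) fun i => |x i|
  have h3 : ‖x‖ ^ 2 = ∑ i, |x i| ^ 2 := by
    simp [EuclideanSpace.norm_sq_eq]
  rw [← h3] at h2
  generalize ∑ i, ‖D (EuclideanSpace.basisFun (Fin N) ℝ i)‖ ^ 2 = S at h0 h2 ⊢
  generalize ∑ i, ‖D (EuclideanSpace.basisFun (Fin N) ℝ i)‖ * |x i| = V at h1 h2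
  refine h1.trans ((le_abs_self V).trans (abs_le_of_sq_le_sq ?_ (by positivity)))
  rwa [mul_pow, Real.sq_sqrt h0]

theorem le_meshSize (τ : Fin (K + 1) → ℝ) (k : Fin K) :
    τ k.succ - τ k.castSucc ≤ meshSize τ :=
  le_ciSup (f := fun k : Fin K => τ k.succ - τ k.castSucc) (finite_range _).bddAbove k

/-- The source of the factor h: one power of each length is bounded by the mesh size, and the other
powers sum to at most T. -/
theorem sum_stepLength_sq_le {T : ℝ} {τ : Fin (K + 1) → ℝ} (hτ : Monotone τ)
    (hτ0 : τ 0 = 0) (hτT : τ (Fin.last K) = T) {t s : ℝ} (ht : t ∈ Icc 0 T) (hs : s ∈ Icc 0 T) :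
    ∑ k, stepLength τ t s k = max s t - s ∧ ∑ k, stepLength τ t s k ^ 2 ≤ meshSize τ * T := by
  have h1 : ∑ k, stepLength τ t s k = max s t - s := by
    rw [sum_stepLength, hτ0, hτT, min_eq_left ht.2, min_eq_right ht.1, max_eq_left hs.1]
  refine ⟨h1, ?_⟩
  have h2 : ∑ k, stepLength τ t s k ^ 2 ≤ meshSize τ * ∑ k, stepLength τ t s k := by
    rw [Finset.mul_sum]
    refine Finset.sum_le_sum fun k _ => ?_
    rw [sq]
    exact mul_le_mul_of_nonneg_right ((stepLength_le hτ t s k).trans (le_meshSize τ k))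
      (stepLength_nonneg hτ t s k)
  have hmesh : 0 ≤ meshSize τ :=
    Real.iSup_nonneg fun k => sub_nonneg.2 (hτ (Fin.castSucc_le_succ k))
  refine h2.trans (mul_le_mul_of_nonneg_left ?_ hmesh)
  rw [h1]
  have := max_le hs.2 ht.2
  linarith [hs.1]

theorem variance_eq : variance A Am p = ∑ S, p S * ‖op (batch Am p S) - op A‖ ^ 2 :=
  Finset.sum_congr rfl fun S _ => by rw [op_sub, mul_comm]

theorem variance_nonneg (hp : ∀ S, 0 ≤ p S) : 0 ≤ variance A Am p :=
  Finset.sum_nonneg fun S _ => mul_nonneg (sq_nonneg _) (hp S)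

/-- The mean squared error of the randomized evolution is of first order in the mesh size. -/
theorem sum_norm_sq_evolution_sub_le {T : ℝ} (hA : A = ∑ m, Am m)
    (hdiss : ∀ (m : Fin M) (x : Vec N), inner ℝ x (op (Am m) x) ≤ 0) (hp : ∀ S, 0 ≤ p S)
    (hp1 : ∑ S, p S = 1) (hπ : ∀ m, 0 < inclProb p m) {τ : Fin (K + 1) → ℝ} (hτ : Monotone τ)
    (hτ0 : τ 0 = 0) (hτT : τ (Fin.last K) = T) {t s : ℝ} (ht : t ∈ Icc 0 T) (hs : s ∈ Icc 0 T) :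
    ∑ ω : Sample K M, ‖(constEvolution A - batchEvolution Am p τ ω) t s‖ ^ 2 * ∏ k, p (ω k) ≤
      N * (9 * (meshSize τ * T) * variance A Am p) := by
  obtain ⟨hsum, hsq⟩ := sum_stepLength_sq_le hτ hτ0 hτT ht hs
  have hconst : constEvolution A t s = evol K (stepLength τ t s) fun _ => op A := by
    rw [evol_const, hsum, constEvolution]
  have hi : ∀ i, ∑ ω : Sample K M, ‖(constEvolution A - batchEvolution Am p τ ω) t s
      (EuclideanSpace.basisFun (Fin N) ℝ i)‖ ^ 2 * ∏ k, p (ω k) ≤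
      9 * (meshSize τ * T) * variance A Am p := by
    intro i
    have h1 : ‖EuclideanSpace.basisFun (Fin N) ℝ i‖ ≤ 1 := by simp
    -- Both products start from the same unit vector: ρ = 1 and the initial error is zero.
    have h := sum_norm_sq_evol_le hp hp1 (inner_op_sum_nonpos hA hdiss)
      (inner_op_batch_nonpos hdiss hπ) (sum_smul_op_batch hA hπ) (stepLength_nonneg hτ t s) h1 h1
    rw [← variance_eq, sub_self, norm_zero] at h
    have h2 : ∀ ω : Sample K M, ‖(constEvolution A - batchEvolution Am p τ ω) t s
        (EuclideanSpace.basisFun (Fin N) ℝ i)‖ =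
        ‖evol K (stepLength τ t s) (fun k => op (batch Am p (ω k)))
          (EuclideanSpace.basisFun (Fin N) ℝ i) - evol K (stepLength τ t s) (fun _ => op A)
          (EuclideanSpace.basisFun (Fin N) ℝ i)‖ := by
      intro ω
      rw [norm_sub_rev, ← hconst]
      rfl
    simp only [h2]
    refine h.trans ?_
    have h3 := mul_le_mul_of_nonneg_right hsq (variance_nonneg (A := A) (Am := Am) hp)
    linarith
  calc _ ≤ ∑ ω : Sample K M, (∑ i, ‖(constEvolution A - batchEvolution Am p τ ω) t s
        (EuclideanSpace.basisFun (Fin N) ℝ i)‖ ^ 2) * ∏ k, p (ω k) := by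
        refine Finset.sum_le_sum fun ω _ => ?_
        exact mul_le_mul_of_nonneg_right (norm_sq_le_sum_norm_sq _)
          (Finset.prod_nonneg fun k _ => hp (ω k))
    _ = ∑ i, ∑ ω : Sample K M, ‖(constEvolution A - batchEvolution Am p τ ω) t s
        (EuclideanSpace.basisFun (Fin N) ℝ i)‖ ^ 2 * ∏ k, p (ω k) := by
      simp only [Finset.sum_mul]
      exact Finset.sum_comm
    _ ≤ ∑ _i : Fin N, 9 * (meshSize τ * T) * variance A Am p :=
      Finset.sum_le_sum fun i _ => hi i
    _ = _ := by simp

end Batch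

end RBM

end

/-! ### The error bound for the optimal trajectories -/

theorem corollary2 {N q : ℕ} {T : ℝ} (hT : 0 < T)
    (A : Matrix (Fin N) (Fin N) ℝ) (B : Matrix (Fin N) (Fin q) ℝ) (x₀ : RBM.Vec N)
    (Q : Matrix (Fin N) (Fin N) ℝ) (hQ : Q.PosSemidef)
    (R : Matrix (Fin q) (Fin q) ℝ) (hR : R.PosDef) (xd : RBM.L2 T N) :
    ∃ C : ℝ, ∀ (M : ℕ) (Am : Fin M → Matrix (Fin N) (Fin N) ℝ), A = ∑ m, Am m →
      (∀ (m : Fin M) (x : RBM.Vec N), inner ℝ x (RBM.op (Am m) x) ≤ 0) →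
      ∀ p : Finset (Fin M) → ℝ, (∀ S, 0 ≤ p S) → ∑ S, p S = 1 → (∀ m, 0 < RBM.inclProb p m) →
      ∀ (K : ℕ) (τ : Fin (K + 1) → ℝ), StrictMono τ → τ 0 = 0 → τ (Fin.last K) = T →
      ∀ α : ℝ, 0 ≤ α →
        (∀ ω : RBM.Sample K M, StrongConvexOn Set.univ α (RBM.Jh T Am p τ B x₀ Q R xd ω)) →
      ∀ (uStar : RBM.L2 T q) (uhStar : RBM.Sample K M → RBM.L2 T q),
        IsMinOn (RBM.J T A B x₀ Q R xd) Set.univ uStar →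
        (∀ ω, IsMinOn (RBM.Jh T Am p τ B x₀ Q R xd ω) Set.univ (uhStar ω)) →
      ∀ t ∈ Set.Icc (0 : ℝ) T,
        α ^ 2 * RBM.expect p (fun ω =>
            ‖RBM.trajectory A B x₀ (uhStar ω) t - RBM.trajectory A B x₀ uStar t‖ ^ 2) ≤
          C * RBM.meshSize τ * RBM.variance A Am p := by
  obtain ⟨r, hr, hquad⟩ := RBM.exists_le_quad hR
  -- U bounds the norm of u*, since (r/2)‖u*‖² ≤ J(u*) ≤ J(0).
  set U := √(RBM.J T A B x₀ Q R xd 0 / (r / 2)) with hU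
  set W := ∫ t in Icc 0 T, RBM.costWeight B x₀ Q xd U t ^ 2 with hW
  have hW0 : 0 ≤ W := integral_nonneg fun t => sq_nonneg _
  -- The factors are, in order: the response bound T‖B‖², the squared cost weight W, the time
  -- integrals T(1 + T) of the kernel, and 9NT from its mean squared error. All are fixed before A
  -- is decomposed.
  refine ⟨T * ‖RBM.op B‖ ^ 2 * W * (T * (1 + T)) * (N * (9 * T)), ?_⟩
  intro M Am hA hdiss p hp hp1 hπ K τ hτ hτ0 hτT α hα hconv u w hu hw t ht
  have hev := RBM.isEvolution_constEvolution hT.le (RBM.inner_op_sum_nonpos hA hdiss) B x₀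
  have hevω := fun ω => RBM.isEvolution_batchEvolution hT.le Am p
    (RBM.inner_op_batch_nonpos hdiss hπ) hτ.monotone hτ0 hτT ω B x₀
  have huU : ‖u‖ ≤ U := by
    refine Real.le_sqrt_of_sq_le ?_
    rw [le_div_iff₀ (by positivity), mul_comm]
    exact (hev.le_cost hT.le hQ hquad u).trans (isMinOn_iff.1 hu 0 (mem_univ _))
  have hω : ∀ ω, α ^ 2 *
      ‖RBM.trajectory A B x₀ (w ω) t - RBM.trajectory A B x₀ u t‖ ^ 2 ≤
      T * ‖RBM.op B‖ ^ 2 * W * ∫ t in Icc 0 T,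
        RBM.kernelSq T (RBM.constEvolution A - RBM.batchEvolution Am p τ ω) t := by
    intro ω
    -- Both trajectories use the evolution of A, so the initial value cancels and only the response
    -- to the control difference is left.
    have h1 : RBM.trajectory A B x₀ (w ω) t - RBM.trajectory A B x₀ u t =
        RBM.response (RBM.constEvolution A) B (w ω - u) t := by
      have h := RBM.response_add_smul hev.continuous B u (w ω - u) 1 ht
      rw [one_smul, one_smul, add_sub_cancel] at h
      rw [RBM.trajectory_eq A B x₀ _ ht.1, RBM.trajectory_eq A B x₀ _ ht.1, h]
      abel
    have h2 := hev.norm_response_le (w ω - u) ht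
    have h3 := hev.sq_mul_norm_sub_sq_le (hevω ω) hT.le hα (hconv ω) hu (hw ω) huU
    rw [h1]
    calc _ ≤ α ^ 2 * (√T * ‖RBM.op B‖ * ‖w ω - u‖) ^ 2 := by gcongr
      _ = T * ‖RBM.op B‖ ^ 2 * (α ^ 2 * ‖w ω - u‖ ^ 2) := by
        rw [mul_pow, mul_pow, Real.sq_sqrt hT.le]
        ring
      _ ≤ T * ‖RBM.op B‖ ^ 2 * (_ * W) := by gcongr
      _ = _ := by ring
  have hmean := RBM.sum_mul_integral_kernelSq_le hT.le (fun ω : RBM.Sample K M => ∏ k, p (ω k))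
    (fun ω => hev.continuous_sub (hevω ω)) fun t ht s hs =>
      RBM.sum_norm_sq_evolution_sub_le hA hdiss hp hp1 hπ hτ.monotone hτ0 hτT ht hs
  rw [RBM.expect, Finset.mul_sum]
  calc _ ≤ ∑ ω : RBM.Sample K M, T * ‖RBM.op B‖ ^ 2 * W * ((∫ t in Icc 0 T,
        RBM.kernelSq T (RBM.constEvolution A - RBM.batchEvolution Am p τ ω) t) *
          ∏ k, p (ω k)) := by
        refine Finset.sum_le_sum fun ω _ => ?_
        rw [← mul_assoc, ← mul_assoc]
        exact mul_le_mul_of_nonneg_right (hω ω) (Finset.prod_nonneg fun k _ => hp (ω k))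
    _ ≤ T * ‖RBM.op B‖ ^ 2 * W * (T * (1 + T) *
        (N * (9 * (RBM.meshSize τ * T) * RBM.variance A Am p))) := by
      rw [← Finset.mul_sum]
      gcongr
    _ = _ := by ring
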